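/- Let $s\ge 1$, $I=\{1,\dots,s+1\}$, and let $\overline{\mathbb R}=\mathbb R\cup\{\pm\infty\}$ carry a metric $d$ that generates the topology of the two-point compactification and is strongly equivalent to the Euclidean metric on each compact subset of $\mathbb R$. Let $f_i:\mathbb R\to\mathbb R$ ($i\in I$) be $C^{1}$ diffeomorphisms with $\epsilon$-Hölder continuous derivatives for some $\epsilon>0$, extended by $f_i(\pm\infty)=\pm\infty$, such that: - there is $\lambda>1$ with $f_i'(x)\ge\lambda$ for all $i\in I$, $x\in\mathbb R$; - there is no $x\in\mathbb R$ with $f_i(x)=x$ for all $i\in I$; - there are neighbourhoods $V^{\pm}$ of $\pm\infty$ on each of which every $f_i$ has Lipschitz constant $<1$ with respect to $d$; - (open set condition) there is a non-empty bounded open interval $O\subset\mathbb R$ with $f_i^{-1}(O)\subset O$ for all $i\in I$ and $f_i^{-1}(O)\cap f_j^{-1}(O)=\emptyset$ for all $i\ne j$. For $u\in(0,1)^s$ with $\sum_{i\le s}u_i<1$ put $u_{s+1}=1-\sum_{i\le s}u_i$, let $\mu_u$ be the Bernoulli measure with weights $(u_1,\dots,u_{s+1})$ on $\Sigma=I^{\mathbb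 N}$, and for $x\in\overline{\mathbb R}$ let $$T_u(x)=\mu_u\Big\{\omega\in\Sigma:\ \lim_{n\to\infty}f_{\omega_n}\circ\dots\circ f_{\omega_1}(x)=+\infty\Big\}.$$ Fix $p\in(0,1)^s$ with $\sum_{i\le s}p_i<1$. For $n\in\mathbb N_0^s$ let $C_n(x)=\frac{\partial^{n_1+\dots+n_s}}{\partial u_1^{n_1}\cdots\partial u_s^{n_s}}T_u(x)\big|_{u=p}$, and let $\mathcal T$ be the real linear span of all functions $C_n:\overline{\mathbb R}\to\mathbb R$. For $s=1$ write $C_n=C_{(n)}$, $n\in\mathbb N_0$. For $\omega\in\Sigma$ let $\pi(\omega)$ be the unique $x\in\mathbb R$ whose orbit $(f_{\omega_n}\circ\dots\circ f_{\omega_1}(x))_{n\ge1}$ stays outside $V$, where $V$ is the union of a neighbourhood of $+\infty$ and one of $-\infty$ whose points tend to $+\infty$, respectively $-\infty$, along every sequence in $\Sigma$ (the point $\pi(\omega)$ does not depend on the choice of $V$). Put $\varphi(\omega)=-\log|f_{\omega_1}'(\pi(\omega))|$, $\psi(\omega)=\log p_{\omega_1}$, let $\sigma$ be the left shift on $\Sigma$,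 $S_nu=\sum_{k=0}^{n-1}u\circ\sigma^k$ for $u:\Sigma\to\mathbb R$, and $$\alpha_-=\inf_{\omega\in\Sigma}\liminf_{n\to\infty}\frac{S_n\psi(\omega)}{S_n\varphi(\omega)},\qquad \alpha_+=\sup_{\omega\in\Sigma}\limsup_{n\to\infty}\frac{S_n\psi(\omega)}{S_n\varphi(\omega)}.$$ Let $\mathcal C^{\alpha}(\overline{\mathbb R})$ be the set of all $h:\overline{\mathbb R}\to\mathbb R$ with $\sup_{x\ne y}|h(x)-h(y)|/d(x,y)^{\alpha}<\infty$. Then: 1. If $\alpha_-=\alpha_+$, then $\mathcal T\cap\mathcal C^{\alpha_-}(\overline{\mathbb R})=\mathbb R\,T_p$. 2. If $s=1$ and each $f_i$ has constant derivative, then $C_n\notin\mathcal C^{\alpha_-}(\overline{\mathbb R})$ for every $n\ge1$. In particular, in each of these two cases $\mathcal T\not\subset\mathcal C^{\alpha_-}(\overline{\mathbb R})$. -/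

import Mathlib

open Filter Topology MeasureTheory

noncomputable section

namespace GenTakagi

/-! Indices: `I = {1, …, s+1}` is `Fin (s+1)`, its last element playing the role of `s+1`;
`Σ = I^ℕ` is `ℕ → Fin (s+1)`, with first letter `ω 0`; the two-point compactification
of the real line is `EReal`. -/

/-- `d` is a metric on the two-point compactification of `ℝ`, generating its topology and
strongly equivalent to the Euclidean metric on compact subsets of `ℝ`. -/
structure IsCompactificationMetric (d : EReal → EReal → ℝ) : Prop where
  eq_zero_iff : ∀ x y, d x y = 0 ↔ x = y
  symm : ∀ x y, d x y = d y x
  triangle : ∀ x y z, d x z ≤ d x y + d y z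
  nhds_basis : ∀ x, (𝓝 x).HasBasis (fun ε : ℝ => 0 < ε) (fun ε => {y | d y x < ε})
  strongly_equivalent : ∀ K : Set ℝ, IsCompact K → ∃ C : ℝ, 0 < C ∧ ∀ x ∈ K, ∀ y ∈ K,
    C⁻¹ * |x - y| ≤ d (x : EReal) (y : EReal) ∧ d (x : EReal) (y : EReal) ≤ C * |x - y|

/-- The extension of a map of the real line to `ℝ ∪ {±∞}` that fixes `-∞` and `+∞`. -/
def extend (g : ℝ → ℝ) (x : EReal) : EReal :=
  EReal.rec (motive := fun _ => EReal) ⊥ (fun r => ((g r : ℝ) : EReal)) ⊤ x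

/-- A `C¹` diffeomorphism of the real line. -/
def IsC1Diffeo (g : ℝ → ℝ) : Prop :=
  ContDiff ℝ 1 g ∧ ∃ h : ℝ → ℝ, ContDiff ℝ 1 h ∧ Function.LeftInverse h g ∧
    Function.RightInverse h g

/-- `C^{1+ε}` diffeomorphisms with `ε`-Hölder derivatives, for some common `ε > 0`. -/
def IsC1HolderFamily {s : ℕ} (f : Fin (s + 1) → ℝ → ℝ) : Prop :=
  ∃ ε : NNReal, 0 < ε ∧ ∀ i, IsC1Diffeo (f i) ∧ ∃ K : NNReal, HolderWith K ε (deriv (f i))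

def IsExpanding {s : ℕ} (f : Fin (s + 1) → ℝ → ℝ) : Prop :=
  ∃ c : ℝ, 1 < c ∧ ∀ i x, c ≤ deriv (f i) x

def HasNoCommonFixedPoint {s : ℕ} (f : Fin (s + 1) → ℝ → ℝ) : Prop :=
  ¬ ∃ x : ℝ, ∀ i, f i x = x

/-- The Lipschitz constant of `g` on `D` with respect to `d` is strictly less than one. -/
def LipLtOneOn (d : EReal → EReal → ℝ) (g : EReal → EReal) (D : Set EReal) : Prop :=
  ∃ c : ℝ, c < 1 ∧ ∀ x ∈ D, ∀ y ∈ D, d (g x) (g y) ≤ c * d x y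

def IsContractingNearInfinity {s : ℕ} (d : EReal → EReal → ℝ) (f : Fin (s + 1) → ℝ → ℝ) :
    Prop :=
  ∃ Vp ∈ 𝓝 (⊤ : EReal), ∃ Vm ∈ 𝓝 (⊥ : EReal),
    ∀ i, LipLtOneOn d (extend (f i)) Vp ∧ LipLtOneOn d (extend (f i)) Vm

/-- The open set condition: there is a non-empty bounded open interval `O` with
`f_i⁻¹(O) ⊆ O` for all `i` and with `f_i⁻¹(O)`, `f_j⁻¹(O)` disjoint for `i ≠ j`. -/
def OpenSetCondition {s : ℕ} (f : Fin (s + 1) → ℝ → ℝ) : Prop :=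
  ∃ a b : ℝ, a < b ∧ (∀ i, f i ⁻¹' Set.Ioo a b ⊆ Set.Ioo a b) ∧
    ∀ i j, i ≠ j → Disjoint (f i ⁻¹' Set.Ioo a b) (f j ⁻¹' Set.Ioo a b)

/-- `f_{ω|n} = f_{ω_n} ∘ ⋯ ∘ f_{ω_1}` on the compactified line. -/
def wordMap {s : ℕ} (f : Fin (s + 1) → ℝ → ℝ) (ω : ℕ → Fin (s + 1)) : ℕ → EReal → EReal
  | 0 => id
  | n + 1 => fun x => extend (f (ω n)) (wordMap f ω n x)

/-- `V⁺`, `V⁻` are neighbourhoods of `±∞` whose points tend to `±∞` along every sequence. -/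
def AreEscapeNhds {s : ℕ} (f : Fin (s + 1) → ℝ → ℝ) (Vp Vm : Set EReal) : Prop :=
  Vp ∈ 𝓝 (⊤ : EReal) ∧ Vm ∈ 𝓝 (⊥ : EReal) ∧ ∀ ω : ℕ → Fin (s + 1),
    (∀ x ∈ Vp, Tendsto (fun n => wordMap f ω n x) atTop (𝓝 ⊤)) ∧
    (∀ x ∈ Vm, Tendsto (fun n => wordMap f ω n x) atTop (𝓝 ⊥))

/-- `J_ω = ⋂_{n ≥ 1} f_{ω|n}⁻¹(ℝ ∪ {±∞} ∖ V)` with `V = V⁺ ∪ V⁻`; the set does not depend on the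
choice of `V`, because an orbit that enters one such `V` tends to `±∞`. -/
def fiberJulia {s : ℕ} (f : Fin (s + 1) → ℝ → ℝ) (ω : ℕ → Fin (s + 1)) : Set EReal :=
  {x | ∃ Vp Vm : Set EReal, AreEscapeNhds f Vp Vm ∧ ∀ n, 1 ≤ n → wordMap f ω n x ∉ Vp ∪ Vm}

/-- The coding map `π`: for an expanding family `J_ω` consists of exactly one point, which is
real, and `π(ω)` is that point. -/
def coding {s : ℕ} (f : Fin (s + 1) → ℝ → ℝ) (ω : ℕ → Fin (s + 1)) : ℝ :=
  Classical.epsilon (fun x : ℝ => (x : EReal) ∈ fiberJulia f ω)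

/-- The open simplex of parameters. -/
def IsParam {s : ℕ} (p : Fin s → ℝ) : Prop :=
  (∀ i, 0 < p i ∧ p i < 1) ∧ ∑ i, p i < 1

/-- The weights `(p_1, …, p_s, p_{s+1})` with `p_{s+1} = 1 - ∑ p_i`. -/
def weights {s : ℕ} (p : Fin s → ℝ) : Fin (s + 1) → ℝ :=
  Fin.snoc (α := fun _ => ℝ) p (1 - ∑ i, p i)

/-- The distribution of a single letter. -/
def letterMeasure {s : ℕ} (p : Fin s → ℝ) : Measure (Fin (s + 1)) :=
  ∑ i, ENNReal.ofReal (weights p i) • Measure.dirac i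

theorem isProbabilityMeasure_letterMeasure {s : ℕ} {p : Fin s → ℝ} (hp : IsParam p) :
    IsProbabilityMeasure (letterMeasure p) := by
  constructor
  have h0 : ∀ i, 0 ≤ weights p i := by
    intro i
    refine Fin.lastCases ?_ (fun j => ?_) i
    · simpa [weights] using hp.2.le
    · simpa [weights] using (hp.1 j).1.le
  have h1 : ∑ i, weights p i = 1 := by
    simp [weights, Fin.sum_univ_castSucc]
  simp only [letterMeasure, Measure.coe_finsetSum, Finset.sum_apply, Measure.smul_apply,
    measure_univ, smul_eq_mul, mul_one]
  rw [← ENNReal.ofReal_sum_of_nonneg (fun i _ => h0 i), h1, ENNReal.ofReal_one]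

open Classical in
/-- The Bernoulli measure on `Σ` of the parameter `p` in the open simplex (zero for other `p`). -/
def bernoulli {s : ℕ} (p : Fin s → ℝ) : Measure (ℕ → Fin (s + 1)) :=
  if hp : IsParam p then
    haveI := isProbabilityMeasure_letterMeasure hp
    Measure.infinitePi (fun _ : ℕ => letterMeasure p)
  else 0

/-- The probability `T_p(x)` of tending to `+∞` from `x`. -/
def probInfty {s : ℕ} (f : Fin (s + 1) → ℝ → ℝ) (p : Fin s → ℝ) (x : EReal) : ℝ :=
  (bernoulli p).real {ω | Tendsto (fun n => wordMap f ω n x) atTop (𝓝 ⊤)}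

/-- The partial derivative with respect to the `i`-th parameter. -/
def partialDeriv {s : ℕ} (i : Fin s) (g : (Fin s → ℝ) → ℝ) (u : Fin s → ℝ) : ℝ :=
  deriv (fun t : ℝ => g (Function.update u i t)) (u i)

/-- `∂^{n_1 + ⋯ + n_s} / ∂u_1^{n_1} ⋯ ∂u_s^{n_s}`. -/
def mixedPartial {s : ℕ} (n : Fin s → ℕ) (g : (Fin s → ℝ) → ℝ) : (Fin s → ℝ) → ℝ :=
  (List.finRange s).foldr (fun i h => (partialDeriv i)^[n i] h) g

/-- `C_n(x)`: the mixed partial derivative of order `n` of `u ↦ T_u(x)`, taken at `p`. -/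
def takagiFun {s : ℕ} (f : Fin (s + 1) → ℝ → ℝ) (p : Fin s → ℝ) (n : Fin s → ℕ) :
    EReal → ℝ :=
  fun x => mixedPartial n (fun u => probInfty f u x) p

/-- The space `𝒯` of generalised Takagi functions: the real span of all the `C_n`. -/
def takagiSpace {s : ℕ} (f : Fin (s + 1) → ℝ → ℝ) (p : Fin s → ℝ) :
    Submodule ℝ (EReal → ℝ) :=
  Submodule.span ℝ (Set.range (takagiFun f p))

/-- `φ(ω) = -log |f_{ω_1}'(π(ω))|`. -/
def phi {s : ℕ} (f : Fin (s + 1) → ℝ → ℝ) (ω : ℕ → Fin (s + 1)) : ℝ :=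
  -Real.log |deriv (f (ω 0)) (coding f ω)|

/-- `ψ(ω) = log p_{ω_1}`. -/
def psi {s : ℕ} (p : Fin s → ℝ) (ω : ℕ → Fin (s + 1)) : ℝ :=
  Real.log (weights p (ω 0))

/-- The ergodic sum `S_n u = ∑_{k < n} u ∘ σ^k`, `σ` being the left shift. -/
def ergodicSum {s : ℕ} (u : (ℕ → Fin (s + 1)) → ℝ) (n : ℕ) (ω : ℕ → Fin (s + 1)) : ℝ :=
  ∑ k ∈ Finset.range n, u (fun j => ω (j + k))

/-- `α₋`. For the families considered, the quotients `S_n ψ / S_n φ` with `n ≥ 1` stay in a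
compact subset of `(0, ∞)`, uniformly in `ω`, so that the real-valued bounds are the true ones. -/
def alphaMinus {s : ℕ} (f : Fin (s + 1) → ℝ → ℝ) (p : Fin s → ℝ) : ℝ :=
  ⨅ ω : ℕ → Fin (s + 1),
    liminf (fun n => ergodicSum (psi p) n ω / ergodicSum (phi f) n ω) atTop

/-- `α₊`. -/
def alphaPlus {s : ℕ} (f : Fin (s + 1) → ℝ → ℝ) (p : Fin s → ℝ) : ℝ :=
  ⨆ ω : ℕ → Fin (s + 1),
    limsup (fun n => ergodicSum (psi p) n ω / ergodicSum (phi f) n ω) atTop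

/-- The set of `α`-Hölder continuous functions with respect to `d`. -/
def holderSpace (d : EReal → EReal → ℝ) (α : ℝ) : Set (EReal → ℝ) :=
  {h | ∃ K : ℝ, ∀ x y, |h x - h y| ≤ K * d x y ^ α}

end GenTakagi

end

/-!
The inverse branches of the maps `f i` contract, and the open set condition makes them act on an
interval `[a, b]` without overlaps, where `a` and `b` are the smallest and the largest fixed point
of the maps (`exists_isFrame`). An orbit that leaves `[a, b]` tends to `±∞`, so `T_u` is `0` up to
`a` and `1` from `b` on, and it satisfies `T_u = ∑ i, u_i • T_u ∘ f_i` (`probInfty_eq_sum`).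
Iterating this equation along a word `w` shows that on the interval `I_w` of the points that remain
in `[a, b]` along `w`, `T_u` is a copy of `T_u` on `[a, b]`, scaled by the weight `u_w`, with an
offset that is a polynomial in `u` (`IsFrame.exists_probInfty_eq`). At the end points of `I_w` the map `u ↦ T_u` is
therefore a polynomial, and the increment of `C_n` over `I_w` is the derivative `∂^n u_w` at `p`
(`IsFrame.takagiFun_sub`). Smoothness of `u ↦ T_u(x)` at other points `x` plays no role.

If `α₋ = α₊ = α`, then `S_n ψ = α S_n φ` along periodic sequences, and bounded distortion gives
`p_w ≍ |I_w| ^ α` for all words (`IsFrame.exists_weight_comparable`). The bound `p_w ≲ |I_w| ^ α`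
yields the Hölder continuity of `T_p` (`IsFrame.probInfty_mem_holderSpace`). Conversely, let
`h = ∑ r_n C_n` be `α`-Hölder. Then `|∑ r_n ∂^n u_w| ≲ |I_w| ^ α ≲ p_w` at `u = p`. For a word in
the letters `1, …, s` with multiplicities `N_i`, the weight is the monomial `∏ u_i ^ N_i`, so
`∑ r_n ∏ N_i (N_i - 1) ⋯ (N_i - n_i + 1) / p_i ^ n_i` is bounded in `N`. This is a polynomial in
`N`, which forces `r_n = 0` for all `n ≠ 0` (`IsFrame.coeff_eq_zero_of_mem_holderSpace`).

If `s = 1` and the derivatives are constants `κ_i`, then `α₋` is at least the minimum of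
`-log p_i / log κ_i`. For the words `i ^ k`, with `i` attaining this minimum, `|I_w| ^ α₋ ≲ p_w`,
while `∂^n u_w / p_w` is unbounded in `k` (`IsFrame.takagiFun_notMem_holderSpace`).
-/

namespace GenTakagi

/-! ### Expanding systems on an interval -/

/-- The geometric data extracted from the hypotheses: every `f i` is an increasing homeomorphism of
the line that expands distances by the factor `c > 1`, the interval `[a, b]` contains the preimages
`f i ⁻¹' [a, b]`, and these preimages do not overlap (`sep`: on the preimage belonging to `i`,
another map `f j` is constantly on one side of `(a, b)`). Each end point is fixed by one of the
maps, and not all maps fix `b`. -/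
structure IsFrame {s : ℕ} (f : Fin (s + 1) → ℝ → ℝ) (c a b : ℝ) : Prop where
  one_lt : 1 < c
  expand : ∀ i x y, x ≤ y → c * (y - x) ≤ f i y - f i x
  surj : ∀ i, Function.Surjective (f i)
  lt : a < b
  left_le : ∀ i, f i a ≤ a
  le_right : ∀ i, b ≤ f i b
  sep : ∀ i j, i ≠ j → (∀ x, f i x ∈ Set.Icc a b → f j x ≤ a) ∨
    (∀ x, f i x ∈ Set.Icc a b → b ≤ f j x)
  left_fix : ∃ i, f i a = a
  right_fix : ∃ i, f i b = b
  right_lt : ∃ i, b < f i b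

theorem expand_of_isExpanding {s : ℕ} {f : Fin (s + 1) → ℝ → ℝ} {c : ℝ}
    (hf : IsC1HolderFamily f) (hc : ∀ i x, c ≤ deriv (f i) x) (i : Fin (s + 1)) (x y : ℝ)
    (hxy : x ≤ y) : c * (y - x) ≤ f i y - f i x := by
  obtain ⟨ε, -, h⟩ := hf
  exact mul_sub_le_image_sub_of_le_deriv ((h i).1.1.differentiable one_ne_zero) (hc i) hxy

/-- The frame of the smallest and the largest fixed point of the maps `f i`. -/
theorem exists_isFrame {s : ℕ} {f : Fin (s + 1) → ℝ → ℝ} {c : ℝ}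
    (hf : IsC1HolderFamily f) (hc1 : 1 < c) (hc : ∀ i x, c ≤ deriv (f i) x)
    (hfix : HasNoCommonFixedPoint f) (hosc : OpenSetCondition f) : ∃ a b, IsFrame f c a b := by
  have hE := expand_of_isExpanding hf hc
  have hexp : ∀ i x y, x ≤ y → y - x ≤ f i y - f i x := fun i x y hxy => by
    nlinarith [hE i x y hxy]
  have hmono : ∀ i, StrictMono (f i) := fun i x y hxy => by
    linarith [hexp i x y hxy.le]
  have hsurj : ∀ i, Function.Surjective (f i) := by
    obtain ⟨ε, -, h⟩ := hf
    intro i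
    obtain ⟨g, -, -, hg⟩ := (h i).1.2
    exact hg.surjective
  have hcont : ∀ i, Continuous (f i) := fun i =>
    (hmono i).monotone.continuous_of_surjective (hsurj i)
  obtain ⟨A, B, hAB, hsub, hdis⟩ := hosc
  have hA : ∀ i, f i A ≤ A := by
    intro i
    obtain ⟨x, hx⟩ := hsurj i A
    by_contra! hlt
    have hxA : x < A := (hmono i).lt_iff_lt.1 (hx.trans_lt hlt)
    obtain ⟨y, hy⟩ := hsurj i (min (f i A) ((A + B) / 2))
    have h1 : f i y ∈ Set.Ioo A B := by
      rw [hy]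
      exact ⟨lt_min hlt (by linarith), (min_le_right _ _).trans_lt (by linarith)⟩
    have h2 : y ≤ A := (hmono i).le_iff_le.1 (hy.trans_le (min_le_left _ _))
    exact absurd (hsub i h1).1 (not_lt.2 h2)
  have hB : ∀ i, B ≤ f i B := by
    intro i
    obtain ⟨x, hx⟩ := hsurj i B
    by_contra! hlt
    obtain ⟨y, hy⟩ := hsurj i (max (f i B) ((A + B) / 2))
    have h1 : f i y ∈ Set.Ioo A B := by
      rw [hy]
      exact ⟨lt_max_of_lt_right (by linarith), max_lt hlt (by linarith)⟩
    have h2 : B ≤ y := (hmono i).le_iff_le.1 ((le_max_left _ _).trans_eq hy.symm)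
    exact absurd (hsub i h1).2 (not_lt.2 h2)
  have hfp : ∀ i, ∃ x ∈ Set.Icc A B, f i x = x := by
    intro i
    obtain ⟨x, hx, h0⟩ := intermediate_value_Icc (f := fun x => f i x - x) hAB.le
      ((hcont i).sub continuous_id).continuousOn
      (show (0 : ℝ) ∈ Set.Icc _ _ from ⟨by linarith [hA i], by linarith [hB i]⟩)
    exact ⟨x, hx, by simpa [sub_eq_zero] using h0⟩
  choose q hqI hq using hfp
  obtain ⟨i₀, hi₀⟩ := Finite.exists_min q
  obtain ⟨i₁, hi₁⟩ := Finite.exists_max q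
  have hlt : q i₀ < q i₁ := by
    refine lt_of_le_of_ne (hi₀ _) fun h => hfix ⟨q i₀, fun i => ?_⟩
    have : q i = q i₀ := le_antisymm ((hi₁ i).trans_eq h.symm) (hi₀ i)
    rw [← this, hq]
  have hle : ∀ i, q i₁ ≤ f i (q i₁) := fun i => by
    linarith [hexp i _ _ (hi₁ i), hq i]
  refine ⟨q i₀, q i₁, hc1, hE, hsurj, hlt, fun i => ?_, hle, fun i j hij => ?_, ⟨i₀, hq _⟩,
    ⟨i₁, hq _⟩, ?_⟩
  · linarith [hexp i _ _ (hi₀ i), hq i]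
  · obtain ⟨x₁, hx₁⟩ := hsurj i A
    obtain ⟨x₂, hx₂⟩ := hsurj i B
    obtain ⟨y₁, hy₁⟩ := hsurj j A
    obtain ⟨y₂, hy₂⟩ := hsurj j B
    have hx : x₁ < x₂ := (hmono i).lt_iff_lt.1 (by rw [hx₁, hx₂]; exact hAB)
    have hy : y₁ < y₂ := (hmono j).lt_iff_lt.1 (by rw [hy₁, hy₂]; exact hAB)
    have key : x₂ ≤ y₁ ∨ y₂ ≤ x₁ := by
      by_contra! h
      obtain ⟨z, hz₁, hz₂⟩ := exists_between
        (show max x₁ y₁ < min x₂ y₂ from max_lt (lt_min hx h.2) (lt_min h.1 hy))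
      refine Set.disjoint_left.1 (hdis i j hij) (show z ∈ _ from ⟨?_, ?_⟩) ⟨?_, ?_⟩
      · exact hx₁ ▸ hmono i ((le_max_left _ _).trans_lt hz₁)
      · exact hx₂ ▸ hmono i (hz₂.trans_le (min_le_left _ _))
      · exact hy₁ ▸ hmono j ((le_max_right _ _).trans_lt hz₁)
      · exact hy₂ ▸ hmono j (hz₂.trans_le (min_le_right _ _))
    refine key.imp (fun h x hx => ?_) (fun h x hx => ?_)
    · have h1 : x ≤ x₂ := (hmono i).le_iff_le.1 (by rw [hx₂]; exact hx.2.trans (hqI i₁).2)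
      exact ((hmono j).monotone (h1.trans h)).trans (hy₁.le.trans (hqI i₀).1)
    · have h1 : x₁ ≤ x := (hmono i).le_iff_le.1 (by rw [hx₁]; exact (hqI i₀).1.trans hx.1)
      exact ((hqI i₁).2.trans hy₂.ge).trans ((hmono j).monotone (h.trans h1))
  · by_contra! h
    exact hfix ⟨q i₁, fun i => le_antisymm (h i) (hle i)⟩

/-- The restriction of `wordMap f ω n` to the real line. -/
def orbit {s : ℕ} (f : Fin (s + 1) → ℝ → ℝ) (ω : ℕ → Fin (s + 1)) : ℕ → ℝ → ℝ
  | 0 => id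
  | n + 1 => fun x => f (ω n) (orbit f ω n x)

section Orbit

variable {s : ℕ} {f : Fin (s + 1) → ℝ → ℝ} {ω : ℕ → Fin (s + 1)}

@[simp] theorem orbit_zero (x : ℝ) : orbit f ω 0 x = x := rfl

theorem orbit_succ (n : ℕ) (x : ℝ) : orbit f ω (n + 1) x = f (ω n) (orbit f ω n x) := rfl

theorem wordMap_succ (n : ℕ) (x : EReal) :
    wordMap f ω (n + 1) x = extend (f (ω n)) (wordMap f ω n x) := rfl

theorem wordMap_coe (n : ℕ) (x : ℝ) : wordMap f ω n (x : EReal) = (orbit f ω n x : ℝ) := by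
  induction n with
  | zero => rfl
  | succ n ih => rw [wordMap_succ, ih]; rfl

theorem orbit_congr {ω' : ℕ → Fin (s + 1)} {n : ℕ} (h : ∀ k < n, ω k = ω' k) (x : ℝ) :
    orbit f ω n x = orbit f ω' n x := by
  induction n with
  | zero => rfl
  | succ n ih =>
    rw [orbit_succ, orbit_succ, ih fun k hk => h k (hk.trans n.lt_succ_self), h n n.lt_succ_self]

theorem orbit_add (m n : ℕ) (x : ℝ) :
    orbit f ω (m + n) x = orbit f (fun j => ω (j + m)) n (orbit f ω m x) := by
  induction n with
  | zero => rfl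
  | succ n ih => rw [← add_assoc, orbit_succ, orbit_succ, ih, add_comm m n]

theorem wordMap_succ' (n : ℕ) (x : EReal) :
    wordMap f ω (n + 1) x = wordMap f (fun j => ω (j + 1)) n (extend (f (ω 0)) x) := by
  induction n with
  | zero => rfl
  | succ n ih => rw [wordMap_succ, ih, wordMap_succ]

theorem wordMap_top (n : ℕ) : wordMap f ω n ⊤ = ⊤ := by
  induction n with
  | zero => rfl
  | succ n ih => rw [wordMap_succ, ih]; rfl

theorem wordMap_bot (n : ℕ) : wordMap f ω n ⊥ = ⊥ := by
  induction n with
  | zero => rfl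
  | succ n ih => rw [wordMap_succ, ih]; rfl

end Orbit

namespace IsFrame

variable {s : ℕ} {f : Fin (s + 1) → ℝ → ℝ} {c a b : ℝ} {ω : ℕ → Fin (s + 1)}

theorem strictMono (F : IsFrame f c a b) (i : Fin (s + 1)) : StrictMono (f i) := fun x y hxy => by
  nlinarith [F.expand i x y hxy.le, F.one_lt]

theorem abs_expand (F : IsFrame f c a b) (i : Fin (s + 1)) (x y : ℝ) :
    c * |y - x| ≤ |f i y - f i x| := by
  rcases le_total x y with h | h
  · rw [abs_of_nonneg (sub_nonneg.2 h)]
    exact (F.expand i x y h).trans (le_abs_self _)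
  · rw [abs_of_nonpos (sub_nonpos.2 h), neg_sub, abs_sub_comm]
    exact (F.expand i y x h).trans (le_abs_self _)

theorem strictMono_orbit (F : IsFrame f c a b) (n : ℕ) : StrictMono (orbit f ω n) := by
  induction n with
  | zero => exact strictMono_id
  | succ n ih => exact (F.strictMono (ω n)).comp ih

theorem surjective_orbit (F : IsFrame f c a b) (n : ℕ) : Function.Surjective (orbit f ω n) := by
  induction n with
  | zero => exact Function.surjective_id
  | succ n ih => exact (F.surj (ω n)).comp ih

theorem continuous_orbit (F : IsFrame f c a b) (n : ℕ) : Continuous (orbit f ω n) :=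
  (F.strictMono_orbit n).monotone.continuous_of_surjective (F.surjective_orbit n)

theorem abs_orbit_expand (F : IsFrame f c a b) (n : ℕ) (x y : ℝ) :
    c ^ n * |y - x| ≤ |orbit f ω n y - orbit f ω n x| := by
  induction n with
  | zero => simp
  | succ n ih =>
    calc c ^ (n + 1) * |y - x| = c * (c ^ n * |y - x|) := by ring
      _ ≤ c * |orbit f ω n y - orbit f ω n x| :=
        mul_le_mul_of_nonneg_left ih (zero_lt_one.trans F.one_lt).le
      _ ≤ _ := F.abs_expand _ _ _

theorem mem_of_map_mem (F : IsFrame f c a b) {i : Fin (s + 1)} {x : ℝ}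
    (h : f i x ∈ Set.Icc a b) : x ∈ Set.Icc a b :=
  ⟨(F.strictMono i).le_iff_le.1 ((F.left_le i).trans h.1),
    (F.strictMono i).le_iff_le.1 (h.2.trans (F.le_right i))⟩

theorem orbit_mem_of_le (F : IsFrame f c a b) {m n : ℕ} (hmn : m ≤ n) {x : ℝ}
    (h : orbit f ω n x ∈ Set.Icc a b) : orbit f ω m x ∈ Set.Icc a b := by
  induction n, hmn using Nat.le_induction with
  | base => exact h
  | succ n _ ih => exact ih (F.mem_of_map_mem h)

theorem orbit_le_left (F : IsFrame f c a b) {x : ℝ} (hx : x ≤ a) (n : ℕ) :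
    orbit f ω n x ≤ a := by
  induction n with
  | zero => exact hx
  | succ n ih => exact ((F.strictMono _).monotone ih).trans (F.left_le _)

theorem right_le_orbit (F : IsFrame f c a b) {x : ℝ} (hx : b ≤ x) (n : ℕ) :
    b ≤ orbit f ω n x := by
  induction n with
  | zero => exact hx
  | succ n ih => exact (F.le_right _).trans ((F.strictMono _).monotone ih)

/-- Two distinct points cannot both stay in `[a, b]` along an infinite orbit. -/
theorem exists_expand_gt (F : IsFrame f c a b) {x y : ℝ} (hxy : x ≠ y) (M : ℝ) :
    ∃ N, ∀ n ≥ N, ∀ ω : ℕ → Fin (s + 1), M < |orbit f ω n y - orbit f ω n x| := by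
  have hpos : 0 < |y - x| := abs_pos.2 (sub_ne_zero.2 hxy.symm)
  have := (tendsto_pow_atTop_atTop_of_one_lt F.one_lt).atTop_mul_const hpos
  obtain ⟨N, hN⟩ := eventually_atTop.1 (this.eventually_gt_atTop M)
  exact ⟨N, fun n hn ω => (hN n hn).trans_le (F.abs_orbit_expand n x y)⟩

theorem tendsto_orbit_atTop (F : IsFrame f c a b) {x : ℝ} (hx : b < x) :
    Tendsto (fun n => orbit f ω n x) atTop atTop := by
  refine tendsto_atTop_mono (fun n => ?_)
    ((tendsto_pow_atTop_atTop_of_one_lt F.one_lt).atTop_mul_const (sub_pos.2 hx) |>.atTop_add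
      (tendsto_const_nhds (x := b)))
  have h := F.abs_orbit_expand (ω := ω) n b x
  rw [abs_of_pos (sub_pos.2 hx), abs_of_pos (sub_pos.2 (F.strictMono_orbit n hx))] at h
  linarith [F.right_le_orbit (ω := ω) le_rfl n]

theorem tendsto_orbit_atBot (F : IsFrame f c a b) {x : ℝ} (hx : x < a) :
    Tendsto (fun n => orbit f ω n x) atTop atBot := by
  refine tendsto_atBot_mono (fun n => ?_)
    (tendsto_neg_atTop_atBot.comp ((tendsto_pow_atTop_atTop_of_one_lt
      F.one_lt).atTop_mul_const (sub_pos.2 hx)) |>.atBot_add (tendsto_const_nhds (x := a)))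
  have h := F.abs_orbit_expand (ω := ω) n x a
  rw [abs_of_pos (sub_pos.2 hx), abs_of_pos (sub_pos.2 (F.strictMono_orbit n hx))] at h
  simp only [Function.comp_apply]
  linarith [F.orbit_le_left (ω := ω) le_rfl n]

/-! ### The coding map -/

theorem areEscapeNhds (F : IsFrame f c a b) :
    AreEscapeNhds f (Set.Ioi (b : EReal)) (Set.Iio (a : EReal)) := by
  refine ⟨Ioi_mem_nhds (EReal.coe_lt_top b), Iio_mem_nhds (EReal.bot_lt_coe a), fun ω =>
    ⟨fun x hx => ?_, fun x hx => ?_⟩⟩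
  · induction x with
    | bot => simp at hx
    | top => simp only [wordMap_top]; exact tendsto_const_nhds
    | coe x =>
      simp only [wordMap_coe]
      exact EReal.tendsto_coe_nhds_top_iff.2 (F.tendsto_orbit_atTop (EReal.coe_lt_coe_iff.1 hx))
  · induction x with
    | top => simp at hx
    | bot => simp only [wordMap_bot]; exact tendsto_const_nhds
    | coe x =>
      simp only [wordMap_coe]
      exact EReal.tendsto_coe_nhds_bot_iff.2 (F.tendsto_orbit_atBot (EReal.coe_lt_coe_iff.1 hx))

theorem exists_orbit_mem (F : IsFrame f c a b) (ω : ℕ → Fin (s + 1)) :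
    ∃ x, ∀ n, orbit f ω n x ∈ Set.Icc a b := by
  have hne : (⋂ n, orbit f ω n ⁻¹' Set.Icc a b).Nonempty := by
    refine IsCompact.nonempty_iInter_of_sequence_nonempty_isCompact_isClosed _ (fun n x hx => ?_)
      (fun n => ?_) ?_ (fun n => isClosed_Icc.preimage (F.continuous_orbit n))
    · exact F.mem_of_map_mem hx
    · obtain ⟨x, hx⟩ := F.surjective_orbit (ω := ω) n a
      exact ⟨x, by rw [Set.mem_preimage, hx]; exact Set.left_mem_Icc.2 F.lt.le⟩
    · exact isCompact_Icc
  obtain ⟨x, hx⟩ := hne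
  exact ⟨x, fun n => Set.mem_iInter.1 hx n⟩

theorem mem_fiberJulia (F : IsFrame f c a b) {x : ℝ} (h : ∀ n, orbit f ω n x ∈ Set.Icc a b) :
    (x : EReal) ∈ fiberJulia f ω := by
  refine ⟨_, _, F.areEscapeNhds, fun n _ => ?_⟩
  rw [wordMap_coe]
  rintro (h' | h')
  · exact absurd (h n).2 (not_le.2 (EReal.coe_lt_coe_iff.1 h'))
  · exact absurd (h n).1 (not_le.2 (EReal.coe_lt_coe_iff.1 h'))

theorem eq_of_mem_fiberJulia (F : IsFrame f c a b) {x y : ℝ}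
    (hx : ∀ n, orbit f ω n x ∈ Set.Icc a b) (hy : (y : EReal) ∈ fiberJulia f ω) : y = x := by
  obtain ⟨Vp, Vm, ⟨hp, hm, -⟩, hV⟩ := hy
  obtain ⟨M, hM⟩ := (nhds_top_basis (α := EReal)).mem_iff.1 hp
  obtain ⟨m, hm⟩ := (nhds_bot_basis (α := EReal)).mem_iff.1 hm
  by_contra hne
  have key : ∀ R : ℝ, ∃ n ≥ 1, R < orbit f ω n y ∨ orbit f ω n y < -R := by
    intro R
    obtain ⟨N, hN⟩ := F.exists_expand_gt (x := x) (y := y) (Ne.symm hne) (|R| + |a| + |b|)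
    refine ⟨N + 1, by omega, ?_⟩
    have h1 := hN (N + 1) (by omega) ω
    have h2 := hx (N + 1)
    rcases lt_abs.1 h1 with h | h
    · left; linarith [neg_abs_le a, abs_nonneg b, le_abs_self R, h2.1]
    · right; linarith [le_abs_self b, abs_nonneg a, le_abs_self R, h2.2]
  obtain ⟨M', hM'⟩ := EReal.lt_iff_exists_real_btwn.1 hM.1
  obtain ⟨m', hm'⟩ := EReal.lt_iff_exists_real_btwn.1 hm.1
  obtain ⟨n, hn, h⟩ := key (max M' (-m'))
  refine hV n hn ?_
  rw [wordMap_coe]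
  rcases h with h | h
  · exact Or.inl (hM.2 (hM'.1.trans (EReal.coe_lt_coe_iff.2 ((le_max_left _ _).trans_lt h))))
  · refine Or.inr (hm.2 (lt_trans (EReal.coe_lt_coe_iff.2 ?_) hm'.2))
    linarith [le_max_right M' (-m')]

/-- The orbit of `π(ω)` along `ω` stays in `[a, b]`. -/
theorem orbit_coding_mem (F : IsFrame f c a b) (ω : ℕ → Fin (s + 1)) (n : ℕ) :
    orbit f ω n (coding f ω) ∈ Set.Icc a b := by
  obtain ⟨x, hx⟩ := F.exists_orbit_mem ω
  have h : ((coding f ω : ℝ) : EReal) ∈ fiberJulia f ω :=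
    Classical.epsilon_spec (p := fun x : ℝ => (x : EReal) ∈ fiberJulia f ω)
      ⟨x, F.mem_fiberJulia hx⟩
  rw [F.eq_of_mem_fiberJulia hx h]
  exact hx n

theorem coding_eq (F : IsFrame f c a b) {x : ℝ} (hx : ∀ n, orbit f ω n x ∈ Set.Icc a b) :
    coding f ω = x :=
  F.eq_of_mem_fiberJulia hx
    (F.mem_fiberJulia fun n => F.orbit_coding_mem ω n)

theorem coding_shift (F : IsFrame f c a b) (ω : ℕ → Fin (s + 1)) (k : ℕ) :
    coding f (fun j => ω (j + k)) = orbit f ω k (coding f ω) :=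
  F.coding_eq fun n => by rw [← orbit_add]; exact F.orbit_coding_mem ω _

end IsFrame

/-! ### Bounded distortion -/

theorem abs_log_sub_log_le {x y : ℝ} (hx : 1 ≤ x) (hy : 1 ≤ y) :
    |Real.log x - Real.log y| ≤ |x - y| := by
  have key : ∀ u v : ℝ, 1 ≤ u → 1 ≤ v → Real.log u - Real.log v ≤ |u - v| := by
    intro u v hu hv
    have hv0 : 0 < v := by linarith
    rw [← Real.log_div (by linarith) hv0.ne']
    calc Real.log (u / v) ≤ u / v - 1 := Real.log_le_sub_one_of_pos (by positivity)
      _ = (u - v) / v := by field_simp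
      _ ≤ |u - v| / v := by gcongr; exact le_abs_self _
      _ ≤ |u - v| := div_le_self (abs_nonneg _) hv
  rw [abs_le]
  constructor
  · have := key y x hy hx
    rw [abs_sub_comm] at this
    linarith
  · exact key x y hx hy

/-- The mean value theorem, with an intermediate point that is no further from `z` than the two
end points are. -/
theorem exists_deriv_eq_of_abs_sub_le {g : ℝ → ℝ} (hg : Differentiable ℝ g) {u v z r : ℝ}
    (hu : |u - z| ≤ r) (hv : |v - z| ≤ r) (huv : u ≠ v) :
    ∃ ξ, |ξ - z| ≤ r ∧ g v - g u = deriv g ξ * (v - u) := by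
  wlog h : u < v generalizing u v
  · obtain ⟨ξ, h1, h2⟩ := this hv hu huv.symm (lt_of_le_of_ne (not_lt.1 h) huv.symm)
    exact ⟨ξ, h1, by linarith⟩
  obtain ⟨ξ, hξ, h'⟩ := exists_deriv_eq_slope g h hg.continuous.continuousOn hg.differentiableOn
  refine ⟨ξ, ?_, ?_⟩
  · rw [abs_le] at *
    constructor <;> linarith [hξ.1, hξ.2, hu.1, hv.2]
  · rw [h', div_mul_cancel₀ _ (sub_pos.2 h).ne']

namespace IsFrame

variable {s : ℕ} {f : Fin (s + 1) → ℝ → ℝ} {c a b : ℝ}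

theorem ergodicSum_phi (F : IsFrame f c a b) (n : ℕ) (ω : ℕ → Fin (s + 1)) :
    ergodicSum (phi f) n ω =
      -∑ k ∈ Finset.range n, Real.log |deriv (f (ω k)) (orbit f ω k (coding f ω))| := by
  simp only [ergodicSum, phi, F.coding_shift, zero_add, Finset.sum_neg_distrib]

/-- The logarithmic distortion along a word is at most `H * r ^ ε`, where `r` measures the size of
the final positions. As `r` shrinks by the factor `c` for each letter removed at the end of the
word, the bound is inductive for a suitable `H`. -/
theorem exists_distortion_le_rpow (F : IsFrame f c a b) (hf : IsC1HolderFamily f)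
    (hc : ∀ i x, c ≤ deriv (f i) x) :
    ∃ H ε : ℝ, 0 ≤ H ∧ 0 < ε ∧ ∀ (ω : ℕ → Fin (s + 1)) (x y z : ℝ), x ≠ y → ∀ (n : ℕ) (r : ℝ),
      |orbit f ω n x - orbit f ω n z| ≤ r → |orbit f ω n y - orbit f ω n z| ≤ r →
      |Real.log (|orbit f ω n y - orbit f ω n x| / |y - x|) -
        (∑ k ∈ Finset.range n, Real.log |deriv (f (ω k)) (orbit f ω k z)|)| ≤ H * r ^ ε := by
  obtain ⟨ε, hε, h⟩ := hf
  choose hdiff K hK using h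
  have hc0 : 0 < c := zero_lt_one.trans F.one_lt
  set L : ℝ := ∑ i, (K i : ℝ) with hL
  have hL0 : 0 ≤ L := Finset.sum_nonneg fun i _ => (K i).2
  have hε' : (0 : ℝ) < ε := hε
  set q : ℝ := (c⁻¹) ^ (ε : ℝ) with hq
  have hq0 : 0 ≤ q := by positivity
  have hq1 : q < 1 := Real.rpow_lt_one (by positivity) (inv_lt_one_of_one_lt₀ F.one_lt) hε'
  have hq1' : 0 < 1 - q := sub_pos.2 hq1
  refine ⟨L * q / (1 - q), ε, by positivity, hε', fun ω x y z hxy n => ?_⟩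
  induction n with
  | zero =>
    intro r hr _
    have hr0 : 0 ≤ r := (abs_nonneg _).trans hr
    have : |y - x| ≠ 0 := abs_ne_zero.2 (sub_ne_zero.2 hxy.symm)
    simp only [orbit_zero, div_self this, Real.log_one, Finset.range_zero, Finset.sum_empty,
      sub_zero, abs_zero]
    positivity
  | succ n ih =>
    intro r hx hy
    have hr0 : 0 ≤ r := (abs_nonneg _).trans hx
    have hshrink : ∀ u v : ℝ, |f (ω n) u - f (ω n) v| ≤ r → |u - v| ≤ c⁻¹ * r := fun u v huv => by
      rw [inv_mul_eq_div, le_div_iff₀ hc0, mul_comm]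
      exact (F.abs_expand _ _ _).trans huv
    have hx' := hshrink _ _ hx
    have hy' := hshrink _ _ hy
    have hne : orbit f ω n x ≠ orbit f ω n y := (F.strictMono_orbit n).injective.ne hxy
    obtain ⟨ξ, hξ, hslope⟩ := exists_deriv_eq_of_abs_sub_le
      ((hdiff (ω n)).1.differentiable one_ne_zero) hx' hy' hne
    have hpos : ∀ u, 1 ≤ |deriv (f (ω n)) u| := fun u =>
      (F.one_lt.le.trans (hc (ω n) u)).trans (le_abs_self _)
    have hstep : |Real.log (|deriv (f (ω n)) ξ|) - Real.log (|deriv (f (ω n)) (orbit f ω n z)|)| ≤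
        L * (q * r ^ (ε : ℝ)) := by
      calc _ ≤ |(|deriv (f (ω n)) ξ| - |deriv (f (ω n)) (orbit f ω n z)|)| :=
            abs_log_sub_log_le (hpos _) (hpos _)
        _ ≤ |deriv (f (ω n)) ξ - deriv (f (ω n)) (orbit f ω n z)| := abs_abs_sub_abs_le _ _
        _ ≤ K (ω n) * (c⁻¹ * r) ^ (ε : ℝ) := by
          have := (hK (ω n)).dist_le_of_le (x := ξ) (y := orbit f ω n z) (d := c⁻¹ * r) hξ
          exact this
        _ ≤ L * (c⁻¹ * r) ^ (ε : ℝ) := by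
          gcongr
          exact Finset.single_le_sum (f := fun i => (K i : ℝ)) (fun i _ => (K i).2)
            (Finset.mem_univ _)
        _ = _ := by rw [Real.mul_rpow (by positivity) hr0]
    have hlog : Real.log (|orbit f ω (n + 1) y - orbit f ω (n + 1) x| / |y - x|) =
        Real.log |deriv (f (ω n)) ξ| + Real.log (|orbit f ω n y - orbit f ω n x| / |y - x|) := by
      rw [orbit_succ, orbit_succ, hslope, abs_mul, mul_div_assoc, Real.log_mul]
      · exact (zero_lt_one.trans_le (hpos _)).ne'
      · exact div_ne_zero (abs_ne_zero.2 (sub_ne_zero.2 hne.symm))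
          (abs_ne_zero.2 (sub_ne_zero.2 hxy.symm))
    rw [hlog, Finset.sum_range_succ]
    have hih := ih (c⁻¹ * r) hx' hy'
    rw [Real.mul_rpow (by positivity) hr0] at hih
    have hsum : L * (q * r ^ (ε : ℝ)) + L * q / (1 - q) * (q * r ^ (ε : ℝ)) =
        L * q / (1 - q) * r ^ (ε : ℝ) := by
      field_simp
      ring
    rw [← hsum]
    refine le_trans (le_of_eq ?_) ((abs_add_le _ _).trans (add_le_add hstep hih))
    congr 1
    ring

/-- Bounded distortion: on the set of points that remain in `[a, b]` for `n` steps, the map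
`f_{ω|n}` expands all distances by the factor `exp (-S_n φ(ω))`, up to a bounded factor. -/
theorem exists_distortion_le (F : IsFrame f c a b) (hf : IsC1HolderFamily f)
    (hc : ∀ i x, c ≤ deriv (f i) x) :
    ∃ D : ℝ, 0 ≤ D ∧ ∀ (ω : ℕ → Fin (s + 1)) (n : ℕ) (x y : ℝ), x ≠ y →
      orbit f ω n x ∈ Set.Icc a b → orbit f ω n y ∈ Set.Icc a b →
      |Real.log (|orbit f ω n y - orbit f ω n x| / |y - x|) + ergodicSum (phi f) n ω| ≤ D := by
  obtain ⟨H, ε, hH, -, h⟩ := F.exists_distortion_le_rpow hf hc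
  have hab : 0 ≤ b - a := (sub_pos.2 F.lt).le
  refine ⟨H * (b - a) ^ ε, by positivity, fun ω n x y hxy hx hy => ?_⟩
  have hz := F.orbit_coding_mem ω n
  rw [F.ergodicSum_phi, ← sub_eq_add_neg]
  exact h ω x y (coding f ω) hxy n (b - a) (abs_sub_le_of_le_of_le hx.1 hx.2 hz.1 hz.2)
    (abs_sub_le_of_le_of_le hy.1 hy.2 hz.1 hz.2)

end IsFrame

/-! ### Weights and ergodic sums -/

theorem weights_pos {s : ℕ} {p : Fin s → ℝ} (hp : IsParam p) (i : Fin (s + 1)) :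
    0 < weights p i := by
  refine Fin.lastCases ?_ (fun j => ?_) i
  · simpa [weights] using hp.2
  · simpa [weights] using (hp.1 j).1

theorem sum_weights {s : ℕ} (p : Fin s → ℝ) : ∑ i, weights p i = 1 := by
  simp [weights, Fin.sum_univ_castSucc]

theorem weights_le_one {s : ℕ} {p : Fin s → ℝ} (hp : IsParam p) (i : Fin (s + 1)) :
    weights p i ≤ 1 := by
  rw [← sum_weights p]
  exact Finset.single_le_sum (fun j _ => (weights_pos hp j).le) (Finset.mem_univ i)

theorem ergodicSum_add {s : ℕ} (u : (ℕ → Fin (s + 1)) → ℝ) (m n : ℕ) (ω : ℕ → Fin (s + 1)) :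
    ergodicSum u (m + n) ω = ergodicSum u m ω + ergodicSum u n (fun j => ω (j + m)) := by
  simp only [ergodicSum, Finset.sum_range_add, add_comm, add_left_comm]

theorem ergodicSum_mul_of_periodic {s : ℕ} (u : (ℕ → Fin (s + 1)) → ℝ) {n : ℕ}
    {ω : ℕ → Fin (s + 1)} (hω : ∀ j, ω (j + n) = ω j) (k : ℕ) :
    ergodicSum u (n * k) ω = k * ergodicSum u n ω := by
  induction k with
  | zero => simp [ergodicSum]
  | succ k ih =>
    rw [mul_add, mul_one, add_comm (n * k) n, ergodicSum_add]
    simp only [hω, ih]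
    push_cast
    ring

theorem exp_ergodicSum_psi {s : ℕ} {p : Fin s → ℝ} (hp : IsParam p) (n : ℕ)
    (ω : ℕ → Fin (s + 1)) :
    Real.exp (ergodicSum (psi p) n ω) = ∏ k ∈ Finset.range n, weights p (ω k) := by
  simp only [ergodicSum, psi, Real.exp_sum, zero_add]
  exact Finset.prod_congr rfl fun k _ => Real.exp_log (weights_pos hp _)

theorem ergodicSum_psi_nonpos {s : ℕ} {p : Fin s → ℝ} (hp : IsParam p) (n : ℕ)
    (ω : ℕ → Fin (s + 1)) : ergodicSum (psi p) n ω ≤ 0 :=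
  Finset.sum_nonpos fun _ _ => Real.log_nonpos (weights_pos hp _).le (weights_le_one hp _)

theorem phi_le {s : ℕ} {f : Fin (s + 1) → ℝ → ℝ} {c : ℝ} (hc1 : 1 < c)
    (hc : ∀ i x, c ≤ deriv (f i) x) (ω : ℕ → Fin (s + 1)) : phi f ω ≤ -Real.log c :=
  neg_le_neg (Real.log_le_log (by linarith) ((hc _ _).trans (le_abs_self _)))

theorem ergodicSum_phi_le {s : ℕ} {f : Fin (s + 1) → ℝ → ℝ} {c : ℝ} (hc1 : 1 < c)
    (hc : ∀ i x, c ≤ deriv (f i) x) (n : ℕ) (ω : ℕ → Fin (s + 1)) :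
    ergodicSum (phi f) n ω ≤ -(n * Real.log c) := by
  have : ergodicSum (phi f) n ω ≤ ∑ _k ∈ Finset.range n, -Real.log c :=
    Finset.sum_le_sum fun _ _ => phi_le hc1 hc _
  simpa using this

/-- The quotients `S_n ψ / S_n φ` are non-negative and uniformly bounded. -/
theorem exists_ratio_mem_Icc {s : ℕ} {f : Fin (s + 1) → ℝ → ℝ} {c : ℝ} (hc1 : 1 < c)
    (hc : ∀ i x, c ≤ deriv (f i) x) {p : Fin s → ℝ} (hp : IsParam p) :
    ∃ M : ℝ, ∀ n ω, ergodicSum (psi p) n ω / ergodicSum (phi f) n ω ∈ Set.Icc 0 M := by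
  have hlc : 0 < Real.log c := Real.log_pos hc1
  set m : ℝ := ∑ i, -Real.log (weights p i) with hm
  have hm1 : ∀ i, -Real.log (weights p i) ≤ m := fun i =>
    Finset.single_le_sum (f := fun i => -Real.log (weights p i))
      (fun j _ => neg_nonneg.2 (Real.log_nonpos (weights_pos hp j).le (weights_le_one hp j)))
      (Finset.mem_univ i)
  have hm0 : 0 ≤ m := (neg_nonneg.2
    (Real.log_nonpos (weights_pos hp 0).le (weights_le_one hp 0))).trans (hm1 0)
  refine ⟨m / Real.log c, fun n ω => ?_⟩
  have h1 := ergodicSum_phi_le hc1 hc n ω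
  have h2 := ergodicSum_psi_nonpos hp n ω
  have h3 : -ergodicSum (psi p) n ω ≤ n * m := by
    have : ∑ k ∈ Finset.range n, -psi p (fun j => ω (j + k)) ≤ ∑ _k ∈ Finset.range n, m :=
      Finset.sum_le_sum fun _ _ => hm1 _
    simpa [ergodicSum] using this
  rcases n.eq_zero_or_pos with rfl | hn
  · simp only [ergodicSum, Finset.range_zero, Finset.sum_empty, div_zero, Set.mem_Icc, le_refl,
      true_and]
    positivity
  have hn' : (0 : ℝ) < n := Nat.cast_pos.2 hn
  have h4 : 0 < n * Real.log c := by positivity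
  refine ⟨div_nonneg_of_nonpos h2 (by linarith), ?_⟩
  rw [← neg_div_neg_eq, div_le_div_iff₀ (by linarith) hlc]
  calc -ergodicSum (psi p) n ω * Real.log c ≤ n * m * Real.log c := by gcongr
    _ = m * (n * Real.log c) := by ring
    _ ≤ m * -ergodicSum (phi f) n ω := by gcongr; linarith

theorem liminf_ratio_mem {s : ℕ} {f : Fin (s + 1) → ℝ → ℝ} {c : ℝ} (hc1 : 1 < c)
    (hc : ∀ i x, c ≤ deriv (f i) x) {p : Fin s → ℝ} (hp : IsParam p) {r : ℝ}
    {ω : ℕ → Fin (s + 1)}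
    (hr : ∀ n, 1 ≤ n → r ≤ ergodicSum (psi p) n ω / ergodicSum (phi f) n ω) :
    r ≤ liminf (fun n => ergodicSum (psi p) n ω / ergodicSum (phi f) n ω) atTop := by
  obtain ⟨M, hM⟩ := exists_ratio_mem_Icc hc1 hc hp
  exact le_liminf_of_le (isCoboundedUnder_ge_of_le atTop fun n => (hM n ω).2)
    (eventually_atTop.2 ⟨1, fun n hn => hr n hn⟩)

/-- A lower bound for all the quotients `S_n ψ / S_n φ` is a lower bound for `α₋`. -/
theorem le_alphaMinus {s : ℕ} {f : Fin (s + 1) → ℝ → ℝ} {c : ℝ} (hc1 : 1 < c)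
    (hc : ∀ i x, c ≤ deriv (f i) x) {p : Fin s → ℝ} (hp : IsParam p) {r : ℝ}
    (hr : ∀ n ω, 1 ≤ n → r ≤ ergodicSum (psi p) n ω / ergodicSum (phi f) n ω) :
    r ≤ alphaMinus f p :=
  le_ciInf fun ω => liminf_ratio_mem hc1 hc hp fun n hn => hr n ω hn

theorem alphaMinus_nonneg {s : ℕ} {f : Fin (s + 1) → ℝ → ℝ} {c : ℝ} (hc1 : 1 < c)
    (hc : ∀ i x, c ≤ deriv (f i) x) {p : Fin s → ℝ} (hp : IsParam p) : 0 ≤ alphaMinus f p := by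
  obtain ⟨M, hM⟩ := exists_ratio_mem_Icc hc1 hc hp
  exact le_alphaMinus hc1 hc hp fun n ω _ => (hM n ω).1

/-- The average of a periodic sequence over one period is a limit point of the quotients
`S_n ψ / S_n φ`, so that it lies between `α₋` and `α₊`. -/
theorem ratio_mem_of_periodic {s : ℕ} {f : Fin (s + 1) → ℝ → ℝ} {c : ℝ} (hc1 : 1 < c)
    (hc : ∀ i x, c ≤ deriv (f i) x) {p : Fin s → ℝ} (hp : IsParam p) {n : ℕ} (hn : 1 ≤ n)
    {ω : ℕ → Fin (s + 1)} (hω : ∀ j, ω (j + n) = ω j) :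
    ergodicSum (psi p) n ω / ergodicSum (phi f) n ω ∈
      Set.Icc (alphaMinus f p) (alphaPlus f p) := by
  obtain ⟨M, hM⟩ := exists_ratio_mem_Icc hc1 hc hp
  have hbelow : ∀ ω, IsBoundedUnder (· ≥ ·) atTop
      (fun n => ergodicSum (psi p) n ω / ergodicSum (phi f) n ω) := fun ω =>
    isBoundedUnder_of ⟨0, fun n => (hM n ω).1⟩
  have habove : ∀ ω, IsBoundedUnder (· ≤ ·) atTop
      (fun n => ergodicSum (psi p) n ω / ergodicSum (phi f) n ω) := fun ω =>
    isBoundedUnder_of ⟨M, fun n => (hM n ω).2⟩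
  have hfreq : ∃ᶠ m in atTop, ergodicSum (psi p) m ω / ergodicSum (phi f) m ω =
      ergodicSum (psi p) n ω / ergodicSum (phi f) n ω := by
    refine frequently_atTop.2 fun N => ⟨n * (N + 1), ?_, ?_⟩
    · calc N ≤ N + 1 := N.le_succ
        _ ≤ n * (N + 1) := Nat.le_mul_of_pos_left _ hn
    · rw [ergodicSum_mul_of_periodic _ hω, ergodicSum_mul_of_periodic _ hω,
        mul_div_mul_left _ _ (by positivity)]
  constructor
  · refine (ciInf_le ⟨0, ?_⟩ ω).trans
      (liminf_le_of_frequently_le (hfreq.mono fun _ h => h.le) (hbelow ω))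
    rintro _ ⟨ω, rfl⟩
    exact liminf_ratio_mem hc1 hc hp fun n _ => (hM n ω).1
  · refine (le_limsup_of_frequently_le (hfreq.mono fun _ h => h.ge) (habove ω)).trans
      (le_ciSup (f := fun ω => limsup (fun n => ergodicSum (psi p) n ω /
        ergodicSum (phi f) n ω) atTop) ⟨M, ?_⟩ ω)
    rintro _ ⟨ω, rfl⟩
    exact limsup_le_of_le (isCoboundedUnder_le_of_le atTop fun n => (hM n ω).1)
      (Eventually.of_forall fun n => (hM n ω).2)

/-- If `α₋ = α₊ = α`, then the weight of a word is comparable with the `α`-th power of the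
contraction ratio on the corresponding interval: the ergodic sums of `ψ` and `α φ` agree along the
periodic extension of the word, and the distortion is bounded. -/
theorem IsFrame.exists_weight_comparable {s : ℕ} {f : Fin (s + 1) → ℝ → ℝ} {c a b : ℝ}
    (F : IsFrame f c a b) (hf : IsC1HolderFamily f) (hc : ∀ i x, c ≤ deriv (f i) x)
    {p : Fin s → ℝ} (hp : IsParam p) (hα : alphaMinus f p = alphaPlus f p) :
    ∃ M : ℝ, 0 < M ∧ ∀ (ω : ℕ → Fin (s + 1)) (n : ℕ) (x y : ℝ), x ≠ y →
      orbit f ω n x ∈ Set.Icc a b → orbit f ω n y ∈ Set.Icc a b →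
      (∏ k ∈ Finset.range n, weights p (ω k)) *
          |orbit f ω n y - orbit f ω n x| ^ alphaMinus f p ≤ M * |y - x| ^ alphaMinus f p ∧
      |y - x| ^ alphaMinus f p ≤ M * ((∏ k ∈ Finset.range n, weights p (ω k)) *
          |orbit f ω n y - orbit f ω n x| ^ alphaMinus f p) := by
  obtain ⟨D, hD0, hD⟩ := F.exists_distortion_le hf hc
  set α := alphaMinus f p with hαdef
  have hα0 : 0 ≤ α := alphaMinus_nonneg F.one_lt hc hp
  refine ⟨Real.exp (α * D), Real.exp_pos _, fun ω n x y hxy hx hy => ?_⟩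
  rcases n.eq_zero_or_pos with rfl | hn
  · have h1 : 1 ≤ Real.exp (α * D) := Real.one_le_exp (by positivity)
    have h2 : 0 ≤ |y - x| ^ α := by positivity
    simp only [Finset.range_zero, Finset.prod_empty, orbit_zero, one_mul]
    constructor <;> nlinarith
  set ω' : ℕ → Fin (s + 1) := fun j => ω (j % n) with hω'
  have hper : ∀ j, ω' (j + n) = ω' j := fun j => by simp [hω']
  have hagree : ∀ k < n, ω k = ω' k := fun k hk => by simp [hω', Nat.mod_eq_of_lt hk]
  have hprod : ∏ k ∈ Finset.range n, weights p (ω k) = Real.exp (ergodicSum (psi p) n ω') := by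
    rw [exp_ergodicSum_psi hp]
    exact Finset.prod_congr rfl fun k hk => by rw [hagree k (Finset.mem_range.1 hk)]
  have hne : orbit f ω n x ≠ orbit f ω n y := (F.strictMono_orbit n).injective.ne hxy
  have hΔ : 0 < |orbit f ω n y - orbit f ω n x| := abs_pos.2 (sub_ne_zero.2 hne.symm)
  have hδ : 0 < |y - x| := abs_pos.2 (sub_ne_zero.2 hxy.symm)
  have hdist := hD ω' n x y hxy (by rwa [← orbit_congr hagree]) (by rwa [← orbit_congr hagree])
  rw [← orbit_congr hagree, ← orbit_congr hagree, Real.log_div hΔ.ne' hδ.ne', abs_le] at hdist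
  have hratio := ratio_mem_of_periodic F.one_lt hc hp hn hper
  rw [← hα, Set.Icc_self, Set.mem_singleton_iff] at hratio
  have hneg : ergodicSum (phi f) n ω' < 0 := by
    have := ergodicSum_phi_le F.one_lt hc n ω'
    have : 0 < n * Real.log c := mul_pos (Nat.cast_pos.2 hn) (Real.log_pos F.one_lt)
    linarith
  rw [div_eq_iff hneg.ne] at hratio
  rw [hprod, Real.rpow_def_of_pos hΔ, Real.rpow_def_of_pos hδ, ← Real.exp_add, ← Real.exp_add,
    ← Real.exp_add, Real.exp_le_exp, Real.exp_le_exp, hratio]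
  constructor <;> nlinarith

/-! ### The self-similarity of the Bernoulli measure -/

/-- The sequence `ω` with the letter `i` put in front. -/
def prepend {s : ℕ} (i : Fin (s + 1)) (ω : ℕ → Fin (s + 1)) : ℕ → Fin (s + 1)
  | 0 => i
  | n + 1 => ω n

theorem measurable_prepend {s : ℕ} (i : Fin (s + 1)) : Measurable (prepend i) := by
  refine measurable_pi_iff.2 fun n => ?_
  cases n with
  | zero => exact measurable_const
  | succ n => exact measurable_pi_apply n

theorem bernoulli_eq {s : ℕ} {p : Fin s → ℝ} (hp : IsParam p) :
    haveI := isProbabilityMeasure_letterMeasure hp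
    bernoulli p = Measure.infinitePi (fun _ : ℕ => letterMeasure p) := by
  rw [bernoulli, dif_pos hp]

theorem isProbabilityMeasure_bernoulli {s : ℕ} {p : Fin s → ℝ} (hp : IsParam p) :
    IsProbabilityMeasure (bernoulli p) := by
  have := isProbabilityMeasure_letterMeasure hp
  rw [bernoulli_eq hp]
  infer_instance

/-- The Bernoulli measure is the mixture of its images under the maps `prepend i`. -/
theorem bernoulli_eq_sum_map {s : ℕ} {p : Fin s → ℝ} (hp : IsParam p) :
    bernoulli p = ∑ i, ENNReal.ofReal (weights p i) • (bernoulli p).map (prepend i) := by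
  classical
  have := isProbabilityMeasure_letterMeasure hp
  rw [bernoulli_eq hp]
  symm
  refine Measure.eq_infinitePi _ fun S t ht => ?_
  -- Enlarge the finite set of coordinates to an initial segment of `ℕ`.
  obtain ⟨N, hN⟩ : ∃ N, S ⊆ Finset.range (N + 1) :=
    ⟨S.sup id, fun n hn => Finset.mem_range.2 (Nat.lt_succ_of_le (Finset.le_sup (f := id) hn))⟩
  set t' : ℕ → Set (Fin (s + 1)) := fun n => if n ∈ S then t n else Set.univ with ht'
  have hset : (S : Set ℕ).pi t = (Finset.range (N + 1) : Set ℕ).pi t' := by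
    ext ω
    simp only [Set.mem_pi, Finset.mem_coe, ht']
    constructor
    · intro h n _
      split_ifs with hn
      · exact h n hn
      · trivial
    · intro h n hn
      simpa [hn] using h n (hN hn)
  have hprod : ∏ n ∈ S, letterMeasure p (t n) =
      ∏ n ∈ Finset.range (N + 1), letterMeasure p (t' n) := by
    rw [← Finset.prod_subset hN fun n _ hn => by simp [ht', hn]]
    exact Finset.prod_congr rfl fun n hn => by simp [ht', hn]
  rw [hset, hprod, Finset.prod_range_succ']
  have hmeas : MeasurableSet ((Finset.range (N + 1) : Set ℕ).pi t') :=
    MeasurableSet.pi (Finset.countable_toSet _) fun n _ => MeasurableSet.of_discrete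
  have hpre : ∀ i, (Measure.infinitePi (fun _ : ℕ => letterMeasure p)).map (prepend i)
      ((Finset.range (N + 1) : Set ℕ).pi t') =
      (t' 0).indicator 1 i * ∏ n ∈ Finset.range N, letterMeasure p (t' (n + 1)) := by
    intro i
    rw [Measure.map_apply (measurable_prepend i) hmeas]
    by_cases hi : i ∈ t' 0
    · have : prepend i ⁻¹' (Finset.range (N + 1) : Set ℕ).pi t' =
          (Finset.range N : Set ℕ).pi fun n => t' (n + 1) := by
        ext ω
        simp only [Set.mem_preimage, Set.mem_pi, Finset.mem_coe, Finset.mem_range]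
        constructor
        · intro h n hn
          exact h (n + 1) (by omega)
        · rintro h (_ | n) hn
          · exact hi
          · exact h n (by omega)
      rw [this, Measure.infinitePi_pi _ fun n _ => MeasurableSet.of_discrete]
      simp [hi]
    · have : prepend i ⁻¹' (Finset.range (N + 1) : Set ℕ).pi t' = ∅ := by
        ext ω
        simp only [Set.mem_preimage, Set.mem_pi, Finset.mem_coe, Finset.mem_range,
          Set.mem_empty_iff_false, iff_false]
        exact fun h => hi (h 0 (by omega))
      rw [this]
      simp [hi]
  simp only [Measure.coe_finsetSum, Finset.sum_apply, Measure.smul_apply, smul_eq_mul, hpre]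
  rw [mul_comm (∏ n ∈ Finset.range N, _)]
  simp only [letterMeasure, Measure.coe_finsetSum, Finset.sum_apply, Measure.smul_apply,
    smul_eq_mul, Finset.sum_mul, Measure.dirac_apply, mul_assoc]

section

variable {s : ℕ} {f : Fin (s + 1) → ℝ → ℝ}

theorem isLocallyConstant_wordMap (n : ℕ) (x : EReal) :
    IsLocallyConstant fun ω : ℕ → Fin (s + 1) => wordMap f ω n x := by
  induction n with
  | zero => exact IsLocallyConstant.const x
  | succ n ih =>
    have h : IsLocallyConstant fun ω : ℕ → Fin (s + 1) => ω n :=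
      (IsLocallyConstant.iff_continuous _).2 (continuous_apply n)
    exact h.comp₂ ih fun i z => extend (f i) z

theorem measurableSet_tendsto_top (x : EReal) :
    MeasurableSet {ω : ℕ → Fin (s + 1) | Tendsto (fun n => wordMap f ω n x) atTop (𝓝 ⊤)} :=
  measurableSet_tendsto _ fun n => (isLocallyConstant_wordMap n x).continuous.measurable

/-! ### The distribution function `T_u` -/

/-- The functional equation `T_u = ∑ i, u_i • T_u ∘ f_i`. -/
theorem probInfty_eq_sum {u : Fin s → ℝ} (hu : IsParam u) (x : EReal) :
    probInfty f u x = ∑ i, weights u i * probInfty f u (extend (f i) x) := by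
  have := isProbabilityMeasure_bernoulli hu
  have hpre : ∀ i, prepend i ⁻¹' {ω | Tendsto (fun n => wordMap f ω n x) atTop (𝓝 ⊤)} =
      {ω | Tendsto (fun n => wordMap f ω n (extend (f i) x)) atTop (𝓝 ⊤)} := by
    intro i
    ext ω
    rw [Set.mem_preimage, Set.mem_ofPred_eq, ← tendsto_add_atTop_iff_nat 1]
    simp only [wordMap_succ']
    rfl
  have h := congrArg (fun m => m {ω : ℕ → Fin (s + 1) |
    Tendsto (fun n => wordMap f ω n x) atTop (𝓝 ⊤)}) (bernoulli_eq_sum_map hu)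
  simp only [Measure.coe_finsetSum, Finset.sum_apply, Measure.smul_apply, smul_eq_mul,
    Measure.map_apply (measurable_prepend _) (measurableSet_tendsto_top x), hpre] at h
  simp only [probInfty, Measure.real]
  rw [h, ENNReal.toReal_sum fun i _ => ENNReal.mul_ne_top ENNReal.ofReal_ne_top
    (measure_ne_top _ _)]
  exact Finset.sum_congr rfl fun i _ => by
    rw [ENNReal.toReal_mul, ENNReal.toReal_ofReal (weights_pos hu i).le]

theorem probInfty_top {u : Fin s → ℝ} (hu : IsParam u) : probInfty f u ⊤ = 1 := by
  have := isProbabilityMeasure_bernoulli hu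
  simp [probInfty, wordMap_top]

theorem probInfty_bot (u : Fin s → ℝ) : probInfty f u ⊥ = 0 := by
  have h : ¬ Tendsto (fun _ : ℕ => (⊥ : EReal)) atTop (𝓝 ⊤) := fun h =>
    bot_ne_top (tendsto_nhds_unique tendsto_const_nhds h)
  simp [probInfty, wordMap_bot, h]

theorem probInfty_nonneg (u : Fin s → ℝ) (x : EReal) : 0 ≤ probInfty f u x :=
  measureReal_nonneg

theorem probInfty_le_one {u : Fin s → ℝ} (hu : IsParam u) (x : EReal) : probInfty f u x ≤ 1 := by
  have := isProbabilityMeasure_bernoulli hu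
  exact measureReal_le_one

namespace IsFrame

variable {c a b : ℝ} {u : Fin s → ℝ}

theorem probInfty_mono (F : IsFrame f c a b) (hu : IsParam u) {x y : ℝ} (hxy : x ≤ y) :
    probInfty f u x ≤ probInfty f u y := by
  have := isProbabilityMeasure_bernoulli hu
  refine measureReal_mono fun ω hω => ?_
  refine tendsto_nhds_top_mono hω (Eventually.of_forall fun n => ?_)
  simp only [wordMap_coe]
  exact EReal.coe_le_coe_iff.2 ((F.strictMono_orbit n).monotone hxy)

theorem probInfty_coe_eq_sum (hu : IsParam u) (x : ℝ) :
    probInfty f u x = ∑ i, weights u i * probInfty f u (f i x : ℝ) :=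
  probInfty_eq_sum hu x

theorem probInfty_eq_zero (F : IsFrame f c a b) {x : ℝ} (hx : x ≤ a) :
    probInfty f u x = 0 := by
  have : {ω : ℕ → Fin (s + 1) | Tendsto (fun n => wordMap f ω n x) atTop (𝓝 ⊤)} = ∅ := by
    ext ω
    simp only [Set.mem_ofPred_eq, Set.mem_empty_iff_false, iff_false]
    intro h
    have h1 := le_of_tendsto h (b := (a : EReal)) (Eventually.of_forall fun n => by
      rw [wordMap_coe]
      exact EReal.coe_le_coe_iff.2 (F.orbit_le_left hx n))
    exact absurd h1 (not_le.2 (EReal.coe_lt_top a))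
  simp [probInfty, this]

theorem probInfty_eq_one_of_lt (F : IsFrame f c a b) (hu : IsParam u) {x : ℝ} (hx : b < x) :
    probInfty f u x = 1 := by
  have := isProbabilityMeasure_bernoulli hu
  have h : ∀ ω, Tendsto (fun n => wordMap f ω n x) atTop (𝓝 ⊤) := fun ω =>
    (F.areEscapeNhds.2.2 ω).1 x (EReal.coe_lt_coe_iff.2 hx)
  simp [probInfty, h]

/-- At `b` itself the value is `1` too: some map moves `b` to the right, where `T_u = 1`, and the
functional equation at `b` then leaves no other value. -/
theorem probInfty_eq_one (F : IsFrame f c a b) (hu : IsParam u) {x : ℝ} (hx : b ≤ x) :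
    probInfty f u x = 1 := by
  refine le_antisymm (probInfty_le_one hu _) (le_trans ?_ (F.probInfty_mono hu hx))
  obtain ⟨i, hi⟩ := F.right_lt
  have h1 := probInfty_coe_eq_sum (f := f) hu b
  have h2 : ∑ j, weights u j * (if j = i then 1 else probInfty f u b) ≤ probInfty f u b := by
    conv_rhs => rw [h1]
    refine Finset.sum_le_sum fun j _ => mul_le_mul_of_nonneg_left ?_ (weights_pos hu j).le
    split_ifs with h
    · rw [h, F.probInfty_eq_one_of_lt hu hi]
    · exact F.probInfty_mono hu (F.le_right j)
  have h3 : ∑ j, weights u j * (if j = i then 1 else probInfty f u b) =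
      probInfty f u b + weights u i * (1 - probInfty f u b) := by
    have : ∀ j, weights u j * (if j = i then 1 else probInfty f u b) =
        weights u j * probInfty f u b +
          (if j = i then weights u j * (1 - probInfty f u b) else 0) := by
      intro j
      split_ifs <;> ring
    simp only [this, Finset.sum_add_distrib, ← Finset.sum_mul, sum_weights, one_mul,
      Finset.sum_ite_eq', Finset.mem_univ, if_true]
  nlinarith [weights_pos hu i]

/-- The weight of the letter `i` as a polynomial in the parameters. -/
noncomputable def weightPoly (s : ℕ) : Fin (s + 1) → MvPolynomial (Fin s) ℝ :=
  Fin.snoc (α := fun _ => MvPolynomial (Fin s) ℝ) MvPolynomial.X (1 - ∑ i, MvPolynomial.X i)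

theorem eval_weightPoly (u : Fin s → ℝ) (i : Fin (s + 1)) :
    MvPolynomial.eval u (weightPoly s i) = weights u i := by
  refine Fin.lastCases ?_ (fun j => ?_) i
  · simp [weightPoly, weights]
  · simp [weightPoly, weights]

/-- On the points that remain in `[a, b]` along a word, `T_u` is a rescaled copy of `T_u`. The
offset is a polynomial in the parameter `u`, the same one for all these points. -/
theorem exists_probInfty_eq (F : IsFrame f c a b) (ω : ℕ → Fin (s + 1)) (n : ℕ) :
    ∃ P : MvPolynomial (Fin s) ℝ, ∀ u : Fin s → ℝ, IsParam u → ∀ x : ℝ,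
      orbit f ω n x ∈ Set.Icc a b → probInfty f u x = MvPolynomial.eval u P +
        (∏ k ∈ Finset.range n, weights u (ω k)) * probInfty f u (orbit f ω n x : ℝ) := by
  classical
  induction n with
  | zero => exact ⟨0, fun u _ x _ => by simp⟩
  | succ n ih =>
    obtain ⟨P, hP⟩ := ih
    -- A letter `j ≠ ω n` contributes its full weight or nothing.
    have hj : ∀ j, ∃ κ : ℝ, j ≠ ω n → ∀ u : Fin s → ℝ, IsParam u → ∀ z, f (ω n) z ∈ Set.Icc a b →
        probInfty f u (f j z : ℝ) = κ := by
      intro j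
      by_cases hjn : j = ω n
      · exact ⟨0, fun h => absurd hjn h⟩
      rcases F.sep (ω n) j (Ne.symm hjn) with h | h
      · exact ⟨0, fun _ u _ z hz => F.probInfty_eq_zero (h z hz)⟩
      · exact ⟨1, fun _ u hu z hz => F.probInfty_eq_one hu (h z hz)⟩
    choose κ hκ using hj
    refine ⟨P + (∏ k ∈ Finset.range n, weightPoly s (ω k)) *
      ∑ j ∈ Finset.univ.erase (ω n), MvPolynomial.C (κ j) * weightPoly s j, fun u hu x hx => ?_⟩
    rw [hP u hu x (F.mem_of_map_mem hx), probInfty_coe_eq_sum hu (orbit f ω n x),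
      ← Finset.add_sum_erase _ _ (Finset.mem_univ (ω n)),
      Finset.sum_congr rfl fun j hj' => by
        rw [hκ j (Finset.ne_of_mem_erase hj') u hu _ hx], Finset.prod_range_succ, orbit_succ]
    simp only [map_add, map_mul, map_prod, map_sum, eval_weightPoly, MvPolynomial.eval_C]
    rw [Finset.sum_congr rfl fun j _ => mul_comm (κ j) (weights u j)]
    ring

theorem probInfty_sub (F : IsFrame f c a b) (hu : IsParam u) {ω : ℕ → Fin (s + 1)} {n : ℕ}
    {x y : ℝ} (hx : orbit f ω n x ∈ Set.Icc a b) (hy : orbit f ω n y ∈ Set.Icc a b) :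
    probInfty f u y - probInfty f u x = (∏ k ∈ Finset.range n, weights u (ω k)) *
      (probInfty f u (orbit f ω n y : ℝ) - probInfty f u (orbit f ω n x : ℝ)) := by
  obtain ⟨P, hP⟩ := F.exists_probInfty_eq ω n
  rw [hP u hu x hx, hP u hu y hy]
  ring

end IsFrame

end

/-! ### Iterated partial derivatives of polynomials -/

/-- The formal counterpart of `mixedPartial`. -/
noncomputable def polyMixedPartial {s : ℕ} (n : Fin s → ℕ) (P : MvPolynomial (Fin s) ℝ) :
    MvPolynomial (Fin s) ℝ :=
  (List.finRange s).foldr (fun i Q => (MvPolynomial.pderiv i)^[n i] Q) P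

theorem hasDerivAt_eval_update {s : ℕ} (i : Fin s) (u : Fin s → ℝ) (t : ℝ)
    (P : MvPolynomial (Fin s) ℝ) :
    HasDerivAt (fun t => MvPolynomial.eval (Function.update u i t) P)
      (MvPolynomial.eval (Function.update u i t) (MvPolynomial.pderiv i P)) t := by
  induction P using MvPolynomial.induction_on with
  | C r =>
    simp only [MvPolynomial.eval_C, MvPolynomial.pderiv_C, map_zero]
    exact hasDerivAt_const t r
  | add P Q hP hQ =>
    simp only [map_add]
    exact hP.add hQ
  | mul_X P j hP =>
    have hX : HasDerivAt (fun t => Function.update u i t j)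
        (MvPolynomial.eval (Function.update u i t)
          (MvPolynomial.pderiv i (MvPolynomial.X j))) t := by
      rcases eq_or_ne j i with rfl | h
      · simp only [Function.update_self, MvPolynomial.pderiv_X_self, map_one]
        exact hasDerivAt_id t
      · simpa [h, MvPolynomial.pderiv_X_of_ne h] using hasDerivAt_const t (u j)
    have := hP.mul hX
    simp only [MvPolynomial.pderiv_mul, map_add, map_mul, MvPolynomial.eval_X] at this ⊢
    exact this

theorem isOpen_setOf_isParam (s : ℕ) : IsOpen {u : Fin s → ℝ | IsParam u} := by
  have h1 : IsOpen {u : Fin s → ℝ | ∀ i, 0 < u i ∧ u i < 1} := by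
    simp only [Set.ofPred_forall]
    exact isOpen_iInter_of_finite fun i =>
      (isOpen_lt continuous_const (continuous_apply i)).inter
        (isOpen_lt (continuous_apply i) continuous_const)
  exact h1.inter (isOpen_lt (continuous_finsetSum _ fun i _ => continuous_apply i)
    continuous_const)

theorem partialDeriv_eq_eval {s : ℕ} (i : Fin s) {g : (Fin s → ℝ) → ℝ}
    {P : MvPolynomial (Fin s) ℝ} (h : ∀ u, IsParam u → g u = MvPolynomial.eval u P)
    (u : Fin s → ℝ) (hu : IsParam u) :
    partialDeriv i g u = MvPolynomial.eval u (MvPolynomial.pderiv i P) := by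
  have hcont : Continuous fun t : ℝ => Function.update u i t :=
    continuous_const.update i continuous_id
  have hnhds : ∀ᶠ t in 𝓝 (u i), IsParam (Function.update u i t) := by
    refine hcont.continuousAt.eventually_mem ((isOpen_setOf_isParam s).mem_nhds ?_)
    simpa using hu
  have hd := hasDerivAt_eval_update i u (u i) P
  rw [Function.update_eq_self] at hd
  rw [partialDeriv, Filter.EventuallyEq.deriv_eq (hnhds.mono fun t ht => h _ ht), hd.deriv]

/-- A function that is a polynomial on the parameter simplex has the formal derivatives of this
polynomial as its partial derivatives there. -/
theorem mixedPartial_eq_eval {s : ℕ} (n : Fin s → ℕ) {g : (Fin s → ℝ) → ℝ}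
    {P : MvPolynomial (Fin s) ℝ} (h : ∀ u, IsParam u → g u = MvPolynomial.eval u P)
    (u : Fin s → ℝ) (hu : IsParam u) :
    mixedPartial n g u = MvPolynomial.eval u (polyMixedPartial n P) := by
  rw [mixedPartial, polyMixedPartial]
  induction List.finRange s generalizing u with
  | nil => exact h u hu
  | cons i l ih =>
    simp only [List.foldr_cons]
    induction n i generalizing u with
    | zero => exact ih u hu
    | succ k ihk =>
      rw [Function.iterate_succ_apply', Function.iterate_succ_apply']
      exact partialDeriv_eq_eval i ihk u hu

theorem polyMixedPartial_add {s : ℕ} (n : Fin s → ℕ) (P Q : MvPolynomial (Fin s) ℝ) :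
    polyMixedPartial n (P + Q) = polyMixedPartial n P + polyMixedPartial n Q := by
  rw [polyMixedPartial, polyMixedPartial, polyMixedPartial]
  induction List.finRange s with
  | nil => rfl
  | cons i l ih => rw [List.foldr_cons, List.foldr_cons, List.foldr_cons, ih, iterate_map_add]

theorem iterate_pderiv_monomial {s : ℕ} (i : Fin s) (k : ℕ) (m : Fin s →₀ ℕ) (r : ℝ) :
    (MvPolynomial.pderiv i)^[k] (MvPolynomial.monomial m r) =
      MvPolynomial.monomial (m - Finsupp.single i k) (r * (m i).descFactorial k) := by
  induction k with
  | zero => simp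
  | succ k ih =>
    rw [Function.iterate_succ_apply', ih, MvPolynomial.pderiv_monomial, tsub_tsub,
      ← Finsupp.single_add, Nat.descFactorial_succ, Finsupp.tsub_apply, Finsupp.single_eq_same]
    push_cast
    rw [mul_assoc, mul_comm (((m i).descFactorial k : ℕ) : ℝ)]

theorem eval_polyMixedPartial_prod_X_pow {s : ℕ} (n N : Fin s → ℕ) (u : Fin s → ℝ) :
    MvPolynomial.eval u (polyMixedPartial n (∏ i, MvPolynomial.X i ^ N i)) =
      ∏ i, ((N i).descFactorial (n i) * u i ^ (N i - n i)) := by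
  set m : Fin s →₀ ℕ := Finsupp.equivFunOnFinite.symm N with hm
  have hmono : (∏ i, MvPolynomial.X i ^ N i : MvPolynomial (Fin s) ℝ) =
      MvPolynomial.monomial m 1 := by
    rw [MvPolynomial.monomial_eq, Finsupp.prod_fintype _ _ fun i => pow_zero _]
    simp [hm]
  have key : ∀ l : List (Fin s), l.Nodup →
      l.foldr (fun i Q => (MvPolynomial.pderiv i)^[n i] Q) (MvPolynomial.monomial m (1 : ℝ)) =
        MvPolynomial.monomial (m - (l.map fun i => Finsupp.single i (n i)).sum)
          (l.map fun i => ((m i).descFactorial (n i) : ℝ)).prod := by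
    intro l
    induction l with
    | nil => simp
    | cons i l ih =>
      intro hl
      rw [List.nodup_cons] at hl
      have h0 : (l.map fun j => Finsupp.single j (n j)).sum i = 0 := by
        rw [← Finsupp.applyAddHom_apply, map_list_sum, List.map_map]
        refine List.sum_eq_zero fun z hz => ?_
        obtain ⟨j, hj, rfl⟩ := List.mem_map.1 hz
        have : j ≠ i := fun h => hl.1 (h ▸ hj)
        simp [this.symm]
      rw [List.foldr_cons, ih hl.2, iterate_pderiv_monomial, Finsupp.tsub_apply, h0, tsub_zero,
        List.map_cons, List.map_cons, List.sum_cons, List.prod_cons, tsub_tsub, add_comm,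
        mul_comm]
  rw [hmono, polyMixedPartial, key _ (List.nodup_finRange s), ← Fin.sum_univ_def,
    ← Fin.prod_univ_def, MvPolynomial.eval_monomial, Finsupp.prod_fintype _ _ fun i => pow_zero _,
    ← Finset.prod_mul_distrib]
  refine Finset.prod_congr rfl fun i _ => ?_
  have hsum : (∑ j, Finsupp.single j (n j)) i = n i := by
    rw [Finsupp.finsetSum_apply]
    simp [Finsupp.single_apply]
  rw [Finsupp.tsub_apply, hsum]
  rfl

/-- Every vector of multiplicities is realized by a word without the last letter. -/
theorem exists_word_prod_eq {s : ℕ} (N : Fin s → ℕ) :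
    ∃ (ω : ℕ → Fin (s + 1)) (n : ℕ), ∀ {M : Type} [CommMonoid M] (v : Fin (s + 1) → M),
      ∏ k ∈ Finset.range n, v (ω k) = ∏ i, v (Fin.castSucc i) ^ N i := by
  set m : Multiset (Fin (s + 1)) := ∑ i, N i • {Fin.castSucc i} with hm
  refine ⟨fun k => m.toList.getD k 0, m.toList.length, fun {M} _ v => ?_⟩
  have h1 : ∏ k ∈ Finset.range m.toList.length, v (m.toList.getD k 0) =
      (m.map v).prod := by
    rw [Finset.prod_range]
    conv_rhs => rw [← Multiset.coe_toList m, Multiset.map_coe, Multiset.prod_coe,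
      ← Fin.prod_univ_fun_getElem]
    exact Finset.prod_congr rfl fun i _ => by
      rw [List.getD_eq_getElem _ _ i.2]
  rw [h1, hm, ← Multiset.coe_mapAddMonoidHom, map_sum, Multiset.prod_sum]
  simp [Multiset.map_nsmul, Multiset.prod_nsmul]

/-- A linear combination of products of falling factorials that is bounded on `ℕ ^ s` has only a
constant term. The substitution `N i = t ^ (B ^ i)`, with `B` larger than all exponents, turns the
products into polynomials in `t` of different degrees. -/
theorem eq_zero_of_abs_sum_descFactorial_le {s : ℕ} (r : (Fin s → ℕ) →₀ ℝ) {q : Fin s → ℝ}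
    (hq : ∀ i, q i ≠ 0) {M : ℝ}
    (h : ∀ N : Fin s → ℕ,
      |r.sum fun n z => z * ∏ i, (((N i).descFactorial (n i) : ℝ) * q i ^ n i)| ≤ M)
    {n : Fin s → ℕ} (hn : n ≠ 0) : r n = 0 := by
  classical
  obtain ⟨B, hB⟩ : ∃ B : ℕ, ∀ n ∈ r.support, ∀ i, n i < B := by
    refine ⟨(r.support.sup fun n => Finset.univ.sup n) + 1, fun n hn i => Nat.lt_succ_of_le ?_⟩
    exact (Finset.le_sup (Finset.mem_univ i)).trans
      (Finset.le_sup (f := fun n : Fin s → ℕ => Finset.univ.sup n) hn)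
  by_contra hrn
  have hnS : n ∈ r.support := Finsupp.mem_support_iff.2 hrn
  set e : (Fin s → ℕ) → ℕ := fun n => ∑ i, n i * B ^ (i : ℕ) with he
  have hinj : ∀ n₁ ∈ r.support, ∀ n₂ ∈ r.support, e n₁ = e n₂ → n₁ = n₂ := by
    intro n₁ h₁ n₂ h₂ h
    have := finFunctionFinEquiv.injective (a₁ := fun i => (⟨n₁ i, hB n₁ h₁ i⟩ : Fin B))
      (a₂ := fun i => ⟨n₂ i, hB n₂ h₂ i⟩) (Fin.ext (by
        rw [finFunctionFinEquiv_apply, finFunctionFinEquiv_apply]; exact h))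
    funext i
    exact congrArg Fin.val (congrFun this i)
  set R : (Fin s → ℕ) → Polynomial ℝ := fun n =>
    ∏ i, (Polynomial.C (q i ^ n i) * (descPochhammer ℝ (n i)).comp (Polynomial.X ^ B ^ (i : ℕ)))
    with hR
  have hX : ∀ i : Fin s, (Polynomial.X ^ B ^ (i : ℕ) : Polynomial ℝ).natDegree ≠ 0 := fun i => by
    have := hB n hnS i
    rw [Polynomial.natDegree_X_pow]
    exact pow_ne_zero _ (by omega)
  have hmonic : ∀ (k : ℕ) (i : Fin s),
      ((descPochhammer ℝ k).comp (Polynomial.X ^ B ^ (i : ℕ))).Monic := fun k i =>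
    (monic_descPochhammer ℝ k).comp (Polynomial.monic_X_pow _) (hX i)
  have hRne : ∀ (n : Fin s → ℕ) (i : Fin s), Polynomial.C (q i ^ n i) *
      (descPochhammer ℝ (n i)).comp (Polynomial.X ^ B ^ (i : ℕ)) ≠ 0 := fun n i =>
    mul_ne_zero (Polynomial.C_ne_zero.2 (pow_ne_zero _ (hq i))) (hmonic _ i).ne_zero
  have hRdeg : ∀ n, (R n).natDegree = e n ∧ R n ≠ 0 := by
    refine fun n => ⟨?_, Finset.prod_ne_zero_iff.2 fun i _ => hRne n i⟩
    rw [hR, Polynomial.natDegree_prod _ _ fun i _ => hRne n i]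
    refine Finset.sum_congr rfl fun i _ => ?_
    rw [Polynomial.natDegree_C_mul (pow_ne_zero _ (hq i)), Polynomial.natDegree_comp,
      descPochhammer_natDegree, Polynomial.natDegree_X_pow]
  set P : Polynomial ℝ := ∑ n ∈ r.support, Polynomial.C (r n) * R n with hP
  have hPeval : ∀ t : ℕ, |P.eval (t : ℝ)| ≤ M := by
    intro t
    convert h (fun i => t ^ B ^ (i : ℕ)) using 2
    rw [hP, Polynomial.eval_finsetSum, Finsupp.sum]
    refine Finset.sum_congr rfl fun n _ => ?_
    rw [Polynomial.eval_mul, Polynomial.eval_C, hR, Polynomial.eval_prod]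
    congr 1
    refine Finset.prod_congr rfl fun i _ => ?_
    rw [Polynomial.eval_mul, Polynomial.eval_C, Polynomial.eval_comp, Polynomial.eval_pow,
      Polynomial.eval_X, ← Nat.cast_pow, descPochhammer_eval_eq_descFactorial, mul_comm]
  have hPdeg : P.natDegree = 0 := by
    by_contra hne
    have h1 := (P.abs_tendsto_atTop (Polynomial.natDegree_pos_iff_degree_pos.1
      (Nat.pos_of_ne_zero hne))).comp tendsto_natCast_atTop_atTop
    obtain ⟨t, ht⟩ := (h1.eventually_gt_atTop M).exists
    exact absurd (hPeval t) (not_le.2 ht)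
  obtain ⟨m, hmS, hm⟩ := r.support.exists_max_image e ⟨n, hnS⟩
  have hcoeff : P.coeff (e m) = r m * (R m).leadingCoeff := by
    rw [hP, Polynomial.finsetSum_coeff, Finset.sum_eq_single m]
    · rw [Polynomial.coeff_C_mul, Polynomial.leadingCoeff, (hRdeg m).1]
    · intro k hk hkm
      rw [Polynomial.coeff_C_mul, Polynomial.coeff_eq_zero_of_natDegree_lt, mul_zero]
      rw [(hRdeg k).1]
      exact lt_of_le_of_ne (hm k hk) fun h => hkm (hinj k hk m hmS h)
    · exact fun h => absurd hmS h
  have hcoeff_ne : P.coeff (e m) ≠ 0 := by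
    rw [hcoeff]
    exact mul_ne_zero (Finsupp.mem_support_iff.1 hmS)
      (Polynomial.leadingCoeff_ne_zero.2 (hRdeg m).2)
  have hem : e m = 0 := Nat.le_zero.1 (hPdeg ▸ Polynomial.le_natDegree_of_ne_zero hcoeff_ne)
  have hen : e n = 0 := Nat.le_zero.1 ((hm n hnS).trans hem.le)
  refine hn (funext fun i => ?_)
  have h0 := Finset.sum_eq_zero_iff.1 hen i (Finset.mem_univ i)
  have hB0 : B ≠ 0 := by
    have := hB n hnS i
    omega
  exact (mul_eq_zero.1 h0).resolve_right (pow_ne_zero _ hB0)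

/-! ### Increments of the functions `C_n` over the intervals of a word -/

theorem takagiFun_zero {s : ℕ} (f : Fin (s + 1) → ℝ → ℝ) (p : Fin s → ℝ) :
    takagiFun f p 0 = probInfty f p := by
  funext x
  rw [takagiFun, mixedPartial]
  induction List.finRange s with
  | nil => rfl
  | cons i l ih => exact ih

section

variable {s : ℕ} {f : Fin (s + 1) → ℝ → ℝ} {c a b : ℝ} {p : Fin s → ℝ}

/-- Over the interval of a word `w` the function `T_u` increases by the weight `u_w`, and hence
`C_n` by the corresponding derivative of this weight. -/
theorem IsFrame.takagiFun_sub (F : IsFrame f c a b) (hp : IsParam p) (n : Fin s → ℕ)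
    {ω : ℕ → Fin (s + 1)} {k : ℕ} {x y : ℝ} (hx : orbit f ω k x = a) (hy : orbit f ω k y = b) :
    takagiFun f p n y - takagiFun f p n x =
      MvPolynomial.eval p (polyMixedPartial n (∏ j ∈ Finset.range k, weightPoly s (ω j))) := by
  obtain ⟨P, hP⟩ := F.exists_probInfty_eq ω k
  have h1 : ∀ u, IsParam u → probInfty f u x = MvPolynomial.eval u P := fun u hu => by
    rw [hP u hu x (by rw [hx]; exact Set.left_mem_Icc.2 F.lt.le), hx, F.probInfty_eq_zero le_rfl,
      mul_zero, add_zero]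
  have h2 : ∀ u, IsParam u → probInfty f u y =
      MvPolynomial.eval u (P + ∏ j ∈ Finset.range k, weightPoly s (ω j)) := fun u hu => by
    rw [hP u hu y (by rw [hy]; exact Set.right_mem_Icc.2 F.lt.le), hy, F.probInfty_eq_one hu le_rfl,
      mul_one, map_add, map_prod]
    simp only [eval_weightPoly]
  rw [takagiFun, takagiFun, mixedPartial_eq_eval n h1 p hp, mixedPartial_eq_eval n h2 p hp,
    polyMixedPartial_add, map_add, add_sub_cancel_left]

/-- If the increments of a linear combination of the functions `C_n` over the intervals of words
are at most proportional to the weights, then only `C_0` occurs in it. -/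
theorem IsFrame.coeff_eq_zero_of_abs_sub_le (F : IsFrame f c a b) (hp : IsParam p)
    (r : (Fin s → ℕ) →₀ ℝ) {K : ℝ}
    (hK : ∀ (ω : ℕ → Fin (s + 1)) (k : ℕ) (x y : ℝ), orbit f ω k x = a → orbit f ω k y = b →
      |(r.sum fun n z => z • takagiFun f p n) y - (r.sum fun n z => z • takagiFun f p n) x| ≤
        K * ∏ j ∈ Finset.range k, weights p (ω j))
    {n : Fin s → ℕ} (hn : n ≠ 0) : r n = 0 := by
  refine eq_zero_of_abs_sum_descFactorial_le r (q := fun i => (p i)⁻¹)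
    (fun i => (inv_pos.2 (hp.1 i).1).ne') (M := K) (fun N => ?_) hn
  obtain ⟨ω, k, hω⟩ := exists_word_prod_eq N
  obtain ⟨x, hx⟩ := F.surjective_orbit (ω := ω) k a
  obtain ⟨y, hy⟩ := F.surjective_orbit (ω := ω) k b
  have h := hK ω k x y hx hy
  have hw : ∏ j ∈ Finset.range k, weights p (ω j) = ∏ i, p i ^ N i := by
    rw [hω]
    simp [weights]
  have hW : ∏ j ∈ Finset.range k, weightPoly s (ω j) = ∏ i, MvPolynomial.X i ^ N i := by
    rw [hω]
    simp [weightPoly]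
  have hwpos : 0 < ∏ i, p i ^ N i := Finset.prod_pos fun i _ => pow_pos (hp.1 i).1 _
  have hinc : (r.sum fun n z => z • takagiFun f p n) y -
      (r.sum fun n z => z • takagiFun f p n) x = (∏ i, p i ^ N i) *
        r.sum fun n z => z * ∏ i, (((N i).descFactorial (n i) : ℝ) * (p i)⁻¹ ^ n i) := by
    simp only [Finsupp.sum, Finset.sum_apply, Pi.smul_apply, smul_eq_mul]
    rw [← Finset.sum_sub_distrib, Finset.mul_sum]
    refine Finset.sum_congr rfl fun m _ => ?_
    rw [← mul_sub, F.takagiFun_sub hp m hx hy, hW, eval_polyMixedPartial_prod_X_pow, mul_left_comm,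
      ← Finset.prod_mul_distrib]
    congr 1
    refine Finset.prod_congr rfl fun i _ => ?_
    rcases le_or_gt (m i) (N i) with hle | hlt
    · rw [mul_left_comm, inv_pow, ← div_eq_mul_inv, pow_sub₀ _ (hp.1 i).1.ne' hle, div_eq_mul_inv]
    · simp [Nat.descFactorial_of_lt hlt]
  rw [hinc, hw, abs_mul, abs_of_pos hwpos, mul_comm] at h
  exact le_of_mul_le_mul_right h hwpos

end

/-! ### Hölder continuity of `T_p` on `[a, b]` -/

theorem IsC1HolderFamily.exists_abs_sub_le {s : ℕ} {f : Fin (s + 1) → ℝ → ℝ}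
    (hf : IsC1HolderFamily f) (a b : ℝ) :
    ∃ L : ℝ, 0 < L ∧ ∀ i, ∀ x ∈ Set.Icc a b, ∀ y ∈ Set.Icc a b,
      |f i y - f i x| ≤ L * |y - x| := by
  obtain ⟨ε, -, h⟩ := hf
  have hC : ∀ i, ∃ C, ∀ x ∈ Set.Icc a b, ‖deriv (f i) x‖ ≤ C := fun i =>
    isCompact_Icc.exists_bound_of_continuousOn ((h i).1.1.continuous_deriv le_rfl).continuousOn
  choose C hC using hC
  have hnn : 0 ≤ ∑ i, |C i| := Finset.sum_nonneg fun i _ => abs_nonneg _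
  refine ⟨1 + ∑ i, |C i|, by positivity, fun i x hx y hy => ?_⟩
  refine (convex_Icc a b).norm_image_sub_le_of_norm_deriv_le
    (fun z _ => (h i).1.1.differentiable one_ne_zero z) (fun z hz => (hC i z hz).trans ?_) hx hy
  have := Finset.single_le_sum (f := fun i => |C i|) (fun i _ => abs_nonneg _) (Finset.mem_univ i)
  linarith [le_abs_self (C i)]

namespace IsFrame

variable {s : ℕ} {f : Fin (s + 1) → ℝ → ℝ} {c a b : ℝ} {p : Fin s → ℝ}

theorem prod_weights_pos (hp : IsParam p) (ω : ℕ → Fin (s + 1)) (n : ℕ) :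
    0 < ∏ k ∈ Finset.range n, weights p (ω k) :=
  Finset.prod_pos fun _ _ => weights_pos hp _

theorem abs_probInfty_sub_le_one (hp : IsParam p) (x y : EReal) :
    |probInfty f p y - probInfty f p x| ≤ 1 :=
  abs_sub_le_of_le_of_le (probInfty_nonneg p y) (probInfty_le_one hp y) (probInfty_nonneg p x)
    (probInfty_le_one hp x) |>.trans_eq (sub_zero 1)

/-- The Hölder estimate at an end point `e` of `[a, b]`. Iterate the map `f i` that fixes `e` as
long as the other point remains in `[a, b]`. When it leaves, its distance to `e` has become at
least `b - a`, so that it was bounded below one step earlier. -/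
theorem exists_abs_probInfty_sub_endpoint_le (F : IsFrame f c a b) (hf : IsC1HolderFamily f)
    (hp : IsParam p) {α M : ℝ} (hα : 0 ≤ α)
    (hM : ∀ (ω : ℕ → Fin (s + 1)) (n : ℕ) (x y : ℝ), x ≠ y →
      orbit f ω n x ∈ Set.Icc a b → orbit f ω n y ∈ Set.Icc a b →
      (∏ k ∈ Finset.range n, weights p (ω k)) * |orbit f ω n y - orbit f ω n x| ^ α ≤
        M * |y - x| ^ α) :
    ∃ C : ℝ, 0 ≤ C ∧ ∀ e, e = a ∨ e = b → ∀ y ∈ Set.Icc a b,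
      |probInfty f p y - probInfty f p e| ≤ C * |y - e| ^ α := by
  classical
  obtain ⟨L, hL, hLip⟩ := hf.exists_abs_sub_le a b
  have hab : 0 < b - a := sub_pos.2 F.lt
  set ρ : ℝ := (b - a) / L with hρ
  have hρ0 : 0 < ρ := by positivity
  have hρα : 0 < ρ ^ α := Real.rpow_pos_of_pos hρ0 α
  refine ⟨|M| / ρ ^ α, by positivity, fun e he y hy => ?_⟩
  rcases eq_or_ne e y with rfl | hne
  · rw [sub_self, abs_zero]
    positivity
  have heI : e ∈ Set.Icc a b := by
    rcases he with rfl | rfl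
    · exact Set.left_mem_Icc.2 F.lt.le
    · exact Set.right_mem_Icc.2 F.lt.le
  obtain ⟨i, hi⟩ : ∃ i, f i e = e := by
    rcases he with rfl | rfl
    · exact F.left_fix
    · exact F.right_fix
  set ω : ℕ → Fin (s + 1) := fun _ => i with hω
  have horb : ∀ n, orbit f ω n e = e := by
    intro n
    induction n with
    | zero => rfl
    | succ n ih => rw [orbit_succ, ih, hi]
  have hex : ∃ n, orbit f ω n y ∉ Set.Icc a b := by
    obtain ⟨N, hN⟩ := F.exists_expand_gt hne (b - a)
    refine ⟨N, fun h => ?_⟩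
    have h1 := hN N le_rfl ω
    rw [horb] at h1
    exact absurd (abs_sub_le_of_le_of_le h.1 h.2 heI.1 heI.2) (not_le.2 h1)
  obtain ⟨n, hn⟩ : ∃ n, Nat.find hex = n + 1 := by
    refine Nat.exists_eq_succ_of_ne_zero fun h => ?_
    have := Nat.find_spec hex
    rw [h] at this
    exact this hy
  have hout : orbit f ω (n + 1) y ∉ Set.Icc a b := hn ▸ Nat.find_spec hex
  have hin : orbit f ω n y ∈ Set.Icc a b := by
    have := Nat.find_min hex (m := n) (by omega)
    exact not_not.1 this
  have hfar : b - a ≤ |orbit f ω (n + 1) y - e| := by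
    rcases he with rfl | rfl
    · have h1 := F.strictMono_orbit (ω := ω) (n + 1) (lt_of_le_of_ne hy.1 hne)
      rw [horb] at h1
      have h2 : b < orbit f ω (n + 1) y := by
        by_contra! h
        exact hout ⟨h1.le, h⟩
      rw [abs_of_pos (sub_pos.2 h1)]
      linarith
    · have h1 := F.strictMono_orbit (ω := ω) (n + 1) (lt_of_le_of_ne hy.2 hne.symm)
      rw [horb] at h1
      have h2 : orbit f ω (n + 1) y < a := by
        by_contra! h
        exact hout ⟨h, h1.le⟩
      rw [abs_of_neg (sub_neg.2 h1)]
      linarith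
  have hnear : ρ ≤ |orbit f ω n y - e| := by
    have h1 := hLip i e heI _ hin
    rw [hi] at h1
    rw [hρ, div_le_iff₀ hL, mul_comm]
    exact hfar.trans h1
  have hw := prod_weights_pos hp ω n
  have heI' : orbit f ω n e ∈ Set.Icc a b := by rwa [horb]
  have hmain := hM ω n e y hne heI' hin
  rw [horb] at hmain
  rw [F.probInfty_sub hp heI' hin, horb, abs_mul, abs_of_pos hw, div_mul_eq_mul_div,
    le_div_iff₀ hρα]
  calc _ ≤ (∏ k ∈ Finset.range n, weights p (ω k)) * 1 * |orbit f ω n y - e| ^ α := by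
        gcongr
        exact abs_probInfty_sub_le_one hp _ _
    _ ≤ M * |y - e| ^ α := by rwa [mul_one]
    _ ≤ |M| * |y - e| ^ α := by gcongr; exact le_abs_self M

/-- The Hölder estimate on `[a, b]`. Follow a common word of the two points for as long as
possible. Afterwards no map sends both points into `[a, b]`, so that the estimate at the end points
applies to each term of the functional equation. -/
theorem exists_probInfty_sub_le (F : IsFrame f c a b) (hf : IsC1HolderFamily f)
    (hp : IsParam p) {α M : ℝ} (hα : 0 ≤ α)
    (hM : ∀ (ω : ℕ → Fin (s + 1)) (n : ℕ) (x y : ℝ), x ≠ y →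
      orbit f ω n x ∈ Set.Icc a b → orbit f ω n y ∈ Set.Icc a b →
      (∏ k ∈ Finset.range n, weights p (ω k)) * |orbit f ω n y - orbit f ω n x| ^ α ≤
        M * |y - x| ^ α) :
    ∃ C : ℝ, 0 ≤ C ∧ ∀ x ∈ Set.Icc a b, ∀ y ∈ Set.Icc a b, x < y →
      probInfty f p y - probInfty f p x ≤ C * |y - x| ^ α := by
  classical
  obtain ⟨C, hC0, hC⟩ := F.exists_abs_probInfty_sub_endpoint_le hf hp hα hM
  obtain ⟨L, hL, hLip⟩ := hf.exists_abs_sub_le a b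
  have haI : a ∈ Set.Icc a b := Set.left_mem_Icc.2 F.lt.le
  have hbI : b ∈ Set.Icc a b := Set.right_mem_Icc.2 F.lt.le
  -- If `[a, b]` does not contain both points, then replacing a point outside by the nearest end
  -- point changes neither value and shortens the distance.
  have hsplit : ∀ u v : ℝ, u < v → ¬ (u ∈ Set.Icc a b ∧ v ∈ Set.Icc a b) →
      probInfty f p v - probInfty f p u ≤ C * |v - u| ^ α := by
    intro u v huv hnot
    have hnn : 0 ≤ C * |v - u| ^ α := by positivity
    rcases le_or_gt v a with hva | hav
    · rw [F.probInfty_eq_zero hva, F.probInfty_eq_zero (huv.le.trans hva), sub_zero]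
      exact hnn
    rcases le_or_gt b u with hbu | hub
    · rw [F.probInfty_eq_one hp hbu, F.probInfty_eq_one hp (hbu.trans huv.le), sub_self]
      exact hnn
    rcases lt_or_ge u a with hua | hau
    · rw [F.probInfty_eq_zero hua.le, ← F.probInfty_eq_zero (f := f) (u := p) (le_refl a)]
      rcases le_or_gt v b with hvb | hbv
      · refine (le_abs_self _).trans ((hC a (Or.inl rfl) v ⟨hav.le, hvb⟩).trans ?_)
        gcongr C * ?_ ^ α
        rw [abs_of_pos (sub_pos.2 hav), abs_of_pos (sub_pos.2 huv)]
        linarith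
      · rw [F.probInfty_eq_one hp hbv.le, ← F.probInfty_eq_one (f := f) hp (le_refl b)]
        refine (le_abs_self _).trans ((hC a (Or.inl rfl) b hbI).trans ?_)
        gcongr C * ?_ ^ α
        rw [abs_of_pos (sub_pos.2 F.lt), abs_of_pos (sub_pos.2 huv)]
        linarith
    · have hbv : b < v := by
        by_contra! h
        exact hnot ⟨⟨hau, hub.le⟩, ⟨hav.le, h⟩⟩
      rw [F.probInfty_eq_one hp hbv.le, ← F.probInfty_eq_one (f := f) hp (le_refl b)]
      refine (le_abs_self _).trans ((abs_sub_comm _ _).trans_le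
        ((hC b (Or.inr rfl) u ⟨hau, hub.le⟩).trans ?_))
      gcongr C * ?_ ^ α
      rw [abs_of_neg (sub_neg.2 hub), abs_of_pos (sub_pos.2 huv)]
      linarith
  refine ⟨C * L ^ α * |M|, by positivity, fun x hx y hy hxy => ?_⟩
  have hex : ∃ n, ¬ ∃ ω : ℕ → Fin (s + 1), orbit f ω n x ∈ Set.Icc a b ∧
      orbit f ω n y ∈ Set.Icc a b := by
    obtain ⟨N, hN⟩ := F.exists_expand_gt hxy.ne (b - a)
    refine ⟨N, fun ⟨ω, h1, h2⟩ => ?_⟩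
    exact absurd (abs_sub_le_of_le_of_le h2.1 h2.2 h1.1 h1.2) (not_le.2 (hN N le_rfl ω))
  obtain ⟨n, hn⟩ : ∃ n, Nat.find hex = n + 1 := by
    refine Nat.exists_eq_succ_of_ne_zero fun h => ?_
    have := Nat.find_spec hex
    rw [h] at this
    exact this ⟨fun _ => 0, hx, hy⟩
  have hout : ¬ ∃ ω : ℕ → Fin (s + 1), orbit f ω (n + 1) x ∈ Set.Icc a b ∧
      orbit f ω (n + 1) y ∈ Set.Icc a b := hn ▸ Nat.find_spec hex
  obtain ⟨ω, hωx, hωy⟩ := not_not.1 (Nat.find_min hex (m := n) (by omega))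
  have hlt : orbit f ω n x < orbit f ω n y := F.strictMono_orbit n hxy
  have hterm : ∀ i, probInfty f p (f i (orbit f ω n y) : ℝ) -
      probInfty f p (f i (orbit f ω n x) : ℝ) ≤
        C * (L ^ α * |orbit f ω n y - orbit f ω n x| ^ α) := by
    intro i
    refine (hsplit _ _ (F.strictMono i hlt) fun h => hout ⟨Function.update ω n i, ?_⟩).trans ?_
    · have hagree : ∀ k < n, Function.update ω n i k = ω k := fun k hk =>
        Function.update_of_ne hk.ne _ _
      rw [orbit_succ, orbit_succ, Function.update_self, orbit_congr hagree, orbit_congr hagree]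
      exact h
    · rw [← Real.mul_rpow hL.le (abs_nonneg _)]
      gcongr
      exact hLip i _ hωx _ hωy
  have hdiff : probInfty f p (orbit f ω n y : ℝ) - probInfty f p (orbit f ω n x : ℝ) ≤
      C * (L ^ α * |orbit f ω n y - orbit f ω n x| ^ α) := by
    rw [probInfty_coe_eq_sum hp (orbit f ω n y), probInfty_coe_eq_sum hp (orbit f ω n x),
      ← Finset.sum_sub_distrib]
    calc _ ≤ ∑ i, weights p i * (C * (L ^ α * |orbit f ω n y - orbit f ω n x| ^ α)) := by
          refine Finset.sum_le_sum fun i _ => ?_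
          rw [← mul_sub]
          exact mul_le_mul_of_nonneg_left (hterm i) (weights_pos hp i).le
      _ = _ := by rw [← Finset.sum_mul, sum_weights, one_mul]
  have hw := prod_weights_pos hp ω n
  rw [F.probInfty_sub hp hωx hωy]
  calc _ ≤ (∏ k ∈ Finset.range n, weights p (ω k)) *
        (C * (L ^ α * |orbit f ω n y - orbit f ω n x| ^ α)) := by gcongr
    _ = C * L ^ α * ((∏ k ∈ Finset.range n, weights p (ω k)) *
        |orbit f ω n y - orbit f ω n x| ^ α) := by ring
    _ ≤ C * L ^ α * (M * |y - x| ^ α) := by gcongr C * L ^ α * ?_; exact hM ω n x y hxy.ne hωx hωy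
    _ ≤ C * L ^ α * (|M| * |y - x| ^ α) := by gcongr; exact le_abs_self M
    _ = _ := by ring

end IsFrame

/-! ### Hölder continuity on the compactified line -/

namespace IsCompactificationMetric

variable {d : EReal → EReal → ℝ}

theorem nonneg (hd : IsCompactificationMetric d) (x y : EReal) : 0 ≤ d x y := by
  have h1 := hd.triangle x y x
  rw [(hd.eq_zero_iff x x).2 rfl, hd.symm y x] at h1
  linarith

theorem exists_le_of_isCompact (hd : IsCompactificationMetric d) {K U : Set EReal}
    (hK : IsCompact K) (hU : IsOpen U) (hKU : K ⊆ U) :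
    ∃ δ : ℝ, 0 < δ ∧ ∀ x ∈ K, ∀ y ∉ U, δ ≤ d x y := by
  refine hK.induction_on (p := fun S => ∃ δ : ℝ, 0 < δ ∧ ∀ x ∈ S, ∀ y ∉ U, δ ≤ d x y)
    ⟨1, one_pos, fun x hx => hx.elim⟩ ?_ ?_ ?_
  · rintro S T hST ⟨δ, hδ, h⟩
    exact ⟨δ, hδ, fun x hx => h x (hST hx)⟩
  · rintro S T ⟨δ, hδ, h⟩ ⟨δ', hδ', h'⟩
    refine ⟨min δ δ', lt_min hδ hδ', fun x hx y hy => ?_⟩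
    rcases hx with hx | hx
    · exact (min_le_left _ _).trans (h x hx y hy)
    · exact (min_le_right _ _).trans (h' x hx y hy)
  · intro x hx
    obtain ⟨ε, hε, h⟩ := (hd.nhds_basis x).mem_iff.1 (hU.mem_nhds (hKU hx))
    refine ⟨{z | d z x < ε / 2}, mem_nhdsWithin_of_mem_nhds
      ((hd.nhds_basis x).mem_of_mem (half_pos hε)), ε / 2, half_pos hε, fun z hz y hy => ?_⟩
    have h1 : ε ≤ d y x := not_lt.1 fun hlt => hy (h hlt)
    have h2 := hd.triangle y z x
    have h3 : d z x < ε / 2 := hz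
    rw [hd.symm y z] at h2
    linarith

/-- A function that is constant on both sides of `[a, b]` and satisfies a Hölder estimate on
`[a, b]` is Hölder continuous on the compactified line. -/
theorem mem_holderSpace (hd : IsCompactificationMetric d) {T : EReal → ℝ} {a b α C v w : ℝ}
    (hab : a < b) (hα : 0 ≤ α) (hleft : ∀ x : EReal, x ≤ a → T x = v)
    (hright : ∀ x : EReal, b ≤ x → T x = w) (hbound : ∀ x y, |T y - T x| ≤ 1) (hC0 : 0 ≤ C)
    (hC : ∀ x ∈ Set.Icc a b, ∀ y ∈ Set.Icc a b, x < y →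
      |T (y : ℝ) - T (x : ℝ)| ≤ C * |y - x| ^ α) : T ∈ holderSpace d α := by
  obtain ⟨A, hA, hequiv⟩ := hd.strongly_equivalent (Set.Icc (a - 1) (b + 1)) isCompact_Icc
  obtain ⟨δ₁, hδ₁, h₁⟩ := hd.exists_le_of_isCompact
    (K := Set.Ici ((b + 1 : ℝ) : EReal)) (U := Set.Ioi (b : EReal)) isClosed_Ici.isCompact
    isOpen_Ioi fun x hx => lt_of_lt_of_le (EReal.coe_lt_coe_iff.2 (by linarith)) hx
  obtain ⟨δ₂, hδ₂, h₂⟩ := hd.exists_le_of_isCompact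
    (K := Set.Iic ((a - 1 : ℝ) : EReal)) (U := Set.Iio (a : EReal)) isClosed_Iic.isCompact
    isOpen_Iio fun x hx => lt_of_le_of_lt hx (EReal.coe_lt_coe_iff.2 (by linarith))
  set δ := min δ₁ δ₂ with hδ
  have hδ0 : 0 < δ := lt_min hδ₁ hδ₂
  have hδα : 0 < δ ^ α := Real.rpow_pos_of_pos hδ0 α
  have hA0 : 0 ≤ A := hA.le
  have hclamp : ∀ z : ℝ, T z = T ((max a (min b z) : ℝ) : EReal) := by
    intro z
    rcases le_or_gt z a with h | h
    · rw [hleft z (EReal.coe_le_coe_iff.2 h), max_eq_left ((min_le_right _ _).trans h),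
        hleft a le_rfl]
    rcases le_or_gt b z with h' | h'
    · rw [hright z (EReal.coe_le_coe_iff.2 h'), min_eq_left h', max_eq_right hab.le,
        hright b le_rfl]
    · rw [min_eq_right h'.le, max_eq_right h.le]
  have hclamp_mem : ∀ z : ℝ, max a (min b z) ∈ Set.Icc a b := fun z =>
    ⟨le_max_left _ _, max_le hab.le (min_le_left _ _)⟩
  have hfar : ∀ x y, δ ≤ d x y → |T x - T y| ≤ (C * A ^ α + 1 / δ ^ α) * d x y ^ α := by
    intro x y hxy
    have h1 : δ ^ α ≤ d x y ^ α := by gcongr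
    have hdn := hd.nonneg x y
    calc |T x - T y| ≤ 1 := hbound y x
      _ = 1 / δ ^ α * δ ^ α := by field_simp
      _ ≤ 1 / δ ^ α * d x y ^ α := by gcongr
      _ ≤ _ := by
        gcongr
        have : 0 ≤ C * A ^ α := by positivity
        linarith
  have hzero : ∀ x y, T x = T y → |T x - T y| ≤ (C * A ^ α + 1 / δ ^ α) * d x y ^ α := by
    intro x y h
    have hdn := hd.nonneg x y
    rw [h, sub_self, abs_zero]
    positivity
  refine ⟨C * A ^ α + 1 / δ ^ α, fun x y => ?_⟩
  wlog hxy : x ≤ y generalizing x y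
  · rw [abs_sub_comm, hd.symm]
    exact this y x (le_of_not_ge hxy)
  rcases le_or_gt ((b + 1 : ℝ) : EReal) y with hy | hy
  · rcases lt_or_ge (b : EReal) x with hx | hx
    · exact hzero x y (by rw [hright x hx.le, hright y (hx.le.trans hxy)])
    · refine hfar x y ((min_le_left _ _).trans ?_)
      rw [hd.symm]
      exact h₁ y hy x (not_lt.2 hx)
  rcases le_or_gt x ((a - 1 : ℝ) : EReal) with hx | hx
  · rcases lt_or_ge y (a : EReal) with hya | hya
    · exact hzero x y (by rw [hleft x (hxy.trans hya.le), hleft y hya.le])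
    · exact hfar x y ((min_le_right _ _).trans (h₂ x hx y (not_lt.2 hya)))
  induction x with
  | bot => exact absurd hx not_lt_bot
  | top => exact absurd (hxy.trans_lt hy) not_top_lt
  | coe x =>
  induction y with
  | bot => exact absurd (hx.trans_le hxy) not_lt_bot
  | top => exact absurd hy not_top_lt
  | coe y =>
  have hx' := EReal.coe_lt_coe_iff.1 hx
  have hy' := EReal.coe_lt_coe_iff.1 hy
  have hxy' := EReal.coe_le_coe_iff.1 hxy
  rcases eq_or_lt_of_le (max_le_max (le_refl a) (min_le_min (le_refl b) hxy')) with heq | hlt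
  · exact hzero _ _ (by rw [hclamp x, hclamp y, heq])
  have hdist : |y - x| ≤ A * d x y := by
    have := (hequiv x ⟨hx'.le, hxy'.trans hy'.le⟩ y ⟨hx'.le.trans hxy', hy'.le⟩).1
    rw [inv_mul_eq_div, div_le_iff₀ hA, abs_sub_comm] at this
    linarith
  have hcontr : |max a (min b y) - max a (min b x)| ≤ |y - x| := by
    refine (abs_max_sub_max_le_max _ _ _ _).trans ?_
    rw [sub_self, abs_zero]
    refine max_le (abs_nonneg _) ((abs_min_sub_min_le_max _ _ _ _).trans ?_)
    rw [sub_self, abs_zero]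
    exact max_le (abs_nonneg _) le_rfl
  have hdn := hd.nonneg x y
  rw [hclamp x, hclamp y, abs_sub_comm]
  calc _ ≤ C * |max a (min b y) - max a (min b x)| ^ α := hC _ (hclamp_mem x) _ (hclamp_mem y) hlt
    _ ≤ C * (A * d x y) ^ α := by gcongr; exact hcontr.trans hdist
    _ = C * A ^ α * d x y ^ α := by rw [Real.mul_rpow hA0 hdn, mul_assoc]
    _ ≤ _ := by
      gcongr
      have : 0 ≤ 1 / δ ^ α := by positivity
      linarith

/-- On a bounded interval, Hölder continuity with respect to `d` implies Hölder continuity with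
respect to the Euclidean metric. -/
theorem exists_abs_sub_le_of_mem_holderSpace (hd : IsCompactificationMetric d) {h : EReal → ℝ}
    {α : ℝ} (hα : 0 ≤ α) (hh : h ∈ holderSpace d α) (a b : ℝ) :
    ∃ K : ℝ, 0 ≤ K ∧ ∀ x ∈ Set.Icc a b, ∀ y ∈ Set.Icc a b,
      |h (y : ℝ) - h (x : ℝ)| ≤ K * |y - x| ^ α := by
  obtain ⟨K, hK⟩ := hh
  obtain ⟨A, hA, hequiv⟩ := hd.strongly_equivalent (Set.Icc a b) isCompact_Icc
  refine ⟨|K| * A ^ α, by positivity, fun x hx y hy => ?_⟩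
  have hdn := hd.nonneg y x
  calc |h (y : ℝ) - h (x : ℝ)| ≤ K * d y x ^ α := hK _ _
    _ ≤ |K| * d y x ^ α := by gcongr; exact le_abs_self K
    _ ≤ |K| * (A * |y - x|) ^ α := by gcongr; exact (hequiv y hy x hx).2
    _ = _ := by rw [Real.mul_rpow hA.le (abs_nonneg _), mul_assoc]

end IsCompactificationMetric

variable {s : ℕ} {f : Fin (s + 1) → ℝ → ℝ} {c a b : ℝ} {p : Fin s → ℝ}

/-! ### Equal exponents -/

theorem IsFrame.probInfty_mem_holderSpace (F : IsFrame f c a b) {d : EReal → EReal → ℝ}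
    (hd : IsCompactificationMetric d) (hf : IsC1HolderFamily f)
    (hc : ∀ i x, c ≤ deriv (f i) x) (hp : IsParam p) (hα : alphaMinus f p = alphaPlus f p) :
    probInfty f p ∈ holderSpace d (alphaMinus f p) := by
  have hα0 : 0 ≤ alphaMinus f p := alphaMinus_nonneg F.one_lt hc hp
  obtain ⟨M, -, hM⟩ := F.exists_weight_comparable hf hc hp hα
  obtain ⟨C, hC0, hC⟩ := F.exists_probInfty_sub_le hf hp hα0
    fun ω n x y hxy hx hy => (hM ω n x y hxy hx hy).1
  refine hd.mem_holderSpace F.lt hα0 (v := 0) (w := 1) (fun x hx => ?_) (fun x hx => ?_)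
    (fun x y => IsFrame.abs_probInfty_sub_le_one hp x y) hC0 fun x hx y hy hxy => ?_
  · induction x with
    | bot => exact probInfty_bot p
    | top => exact absurd hx (not_le.2 (EReal.coe_lt_top a))
    | coe x => exact F.probInfty_eq_zero (EReal.coe_le_coe_iff.1 hx)
  · induction x with
    | bot => exact absurd hx (not_le.2 (EReal.bot_lt_coe b))
    | top => exact probInfty_top hp
    | coe x => exact F.probInfty_eq_one hp (EReal.coe_le_coe_iff.1 hx)
  · rw [abs_of_nonneg (sub_nonneg.2 (F.probInfty_mono hp hxy.le))]
    exact hC x hx y hy hxy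

/-- If `α₋ = α₊`, then a linear combination of the functions `C_n` that is `α₋`-Hölder continuous
contains only `C_0`. -/
theorem IsFrame.coeff_eq_zero_of_mem_holderSpace (F : IsFrame f c a b) {d : EReal → EReal → ℝ}
    (hd : IsCompactificationMetric d) (hf : IsC1HolderFamily f)
    (hc : ∀ i x, c ≤ deriv (f i) x) (hp : IsParam p) (hα : alphaMinus f p = alphaPlus f p)
    (r : (Fin s → ℕ) →₀ ℝ)
    (hr : (r.sum fun n z => z • takagiFun f p n) ∈ holderSpace d (alphaMinus f p))
    {n : Fin s → ℕ} (hn : n ≠ 0) : r n = 0 := by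
  have hα0 : 0 ≤ alphaMinus f p := alphaMinus_nonneg F.one_lt hc hp
  obtain ⟨M, -, hM⟩ := F.exists_weight_comparable hf hc hp hα
  obtain ⟨K, hK0, hK⟩ := hd.exists_abs_sub_le_of_mem_holderSpace hα0 hr a b
  refine F.coeff_eq_zero_of_abs_sub_le hp r (K := K * (M * |b - a| ^ alphaMinus f p))
    (fun ω k x y hx hy => ?_) hn
  have hxI : orbit f ω k x ∈ Set.Icc a b := by rw [hx]; exact Set.left_mem_Icc.2 F.lt.le
  have hyI : orbit f ω k y ∈ Set.Icc a b := by rw [hy]; exact Set.right_mem_Icc.2 F.lt.le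
  have hxy : x ≠ y := by
    rintro rfl
    exact F.lt.ne (hx.symm.trans hy)
  have h1 := (hM ω k x y hxy hxI hyI).2
  rw [hx, hy] at h1
  calc _ ≤ K * |y - x| ^ alphaMinus f p :=
        hK x (F.orbit_mem_of_le k.zero_le hxI) y (F.orbit_mem_of_le k.zero_le hyI)
    _ ≤ K * (M * ((∏ j ∈ Finset.range k, weights p (ω j)) * |b - a| ^ alphaMinus f p)) := by
        gcongr
    _ = _ := by ring

/-! ### Constant derivatives -/

/-- For constant derivatives `κ i` the quotients `S_n ψ / S_n φ` are at least as large as the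
smallest of the numbers `-log p_i / log κ_i`, and hence so is `α₋`. -/
theorem exists_weights_le_alphaMinus (hc1 : 1 < c) (hp : IsParam p) {κ : Fin (s + 1) → ℝ}
    (hκ : ∀ i x, deriv (f i) x = κ i) (hcκ : ∀ i, c ≤ κ i) :
    ∃ i, (κ i)⁻¹ ^ alphaMinus f p ≤ weights p i := by
  have hc : ∀ i x, c ≤ deriv (f i) x := fun i x => by rw [hκ]; exact hcκ i
  have hκ0 : ∀ i, 0 < κ i := fun i => by linarith [hcκ i]
  have hlog : ∀ i, 0 < Real.log (κ i) := fun i => Real.log_pos (hc1.trans_le (hcκ i))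
  obtain ⟨i, hi⟩ := Finite.exists_min fun i => -Real.log (weights p i) / Real.log (κ i)
  refine ⟨i, ?_⟩
  have hle : -Real.log (weights p i) / Real.log (κ i) ≤ alphaMinus f p := by
    refine le_alphaMinus hc1 hc hp fun n ω hn => ?_
    have hneg : ergodicSum (phi f) n ω < 0 := by
      have := ergodicSum_phi_le hc1 hc n ω
      have : 0 < n * Real.log c := mul_pos (Nat.cast_pos.2 hn) (Real.log_pos hc1)
      linarith
    rw [le_div_iff_of_neg hneg, ergodicSum, ergodicSum, Finset.mul_sum]
    refine Finset.sum_le_sum fun k _ => ?_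
    have := hi (ω (0 + k))
    rw [le_div_iff₀ (hlog _)] at this
    simp only [psi, phi, hκ, abs_of_pos (hκ0 _)]
    linarith
  rw [div_le_iff₀ (hlog i)] at hle
  rw [Real.rpow_def_of_pos (inv_pos.2 (hκ0 i)), Real.log_inv,
    ← Real.le_log_iff_exp_le (weights_pos hp i)]
  linarith

theorem abs_orbit_sub_of_deriv_eq (hf : IsC1HolderFamily f) {i : Fin (s + 1)} {κ : ℝ}
    (hκ : ∀ x, deriv (f i) x = κ) (k : ℕ) (x y : ℝ) :
    |orbit f (fun _ => i) k y - orbit f (fun _ => i) k x| = |κ| ^ k * |y - x| := by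
  obtain ⟨ε, -, h⟩ := hf
  have hdiff := (h i).1.1.differentiable one_ne_zero
  induction k with
  | zero => simp
  | succ k ih =>
    rw [orbit_succ, orbit_succ]
    rcases eq_or_ne (orbit f (fun _ => i) k x) (orbit f (fun _ => i) k y) with heq | hne
    · rw [heq, sub_self, abs_zero] at ih ⊢
      rw [pow_succ', mul_assoc, ← ih, mul_zero]
    · obtain ⟨ξ, -, hξ⟩ := exists_deriv_eq_of_abs_sub_le hdiff (le_max_left _ _)
        (le_max_right _ _) (z := 0) hne
      rw [hξ, hκ, abs_mul, ih, pow_succ', mul_assoc]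

theorem iterate_pderiv_pow {P : MvPolynomial (Fin s) ℝ} {i : Fin s} {θ : ℝ}
    (hP : MvPolynomial.pderiv i P = MvPolynomial.C θ) (n k : ℕ) :
    (MvPolynomial.pderiv i)^[n] (P ^ k) =
      MvPolynomial.C (θ ^ n * k.descFactorial n) * P ^ (k - n) := by
  induction n with
  | zero => simp
  | succ n ih =>
    rw [Function.iterate_succ_apply', ih, MvPolynomial.pderiv_C_mul, Derivation.leibniz_pow, hP,
      Nat.descFactorial_succ, Nat.sub_sub]
    simp only [smul_eq_mul, nsmul_eq_mul, map_mul, map_pow, map_natCast, Nat.cast_mul]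
    ring

/-- With constant derivatives, consider the words `i ^ k`, where `i` is the letter that minimizes
`-log p_i / log κ_i`. Their intervals have length comparable with `κ_i ^ (-k)`, whose `α₋`-th power
is at most the weight `p_i ^ k`, whereas the increment of `C_n` is larger than this weight by the
unbounded factor `k (k - 1) ⋯ (k - n + 1)`. -/
theorem IsFrame.takagiFun_notMem_holderSpace {f : Fin (1 + 1) → ℝ → ℝ} {p : Fin 1 → ℝ}
    (F : IsFrame f c a b) {d : EReal → EReal → ℝ}
    (hd : IsCompactificationMetric d) (hf : IsC1HolderFamily f)
    (hc : ∀ i x, c ≤ deriv (f i) x) (hp : IsParam p) (hconst : ∀ i, ∃ c, ∀ x, deriv (f i) x = c)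
    {n : ℕ} (hn : 1 ≤ n) : takagiFun f p (fun _ => n) ∉ holderSpace d (alphaMinus f p) := by
  intro hmem
  choose κ hκ using hconst
  have hcκ : ∀ i, c ≤ κ i := fun i => by rw [← hκ i 0]; exact hc i 0
  have hα0 : 0 ≤ alphaMinus f p := alphaMinus_nonneg F.one_lt hc hp
  obtain ⟨K, hK0, hK⟩ := hd.exists_abs_sub_le_of_mem_holderSpace hα0 hmem a b
  obtain ⟨i, hi⟩ := exists_weights_le_alphaMinus F.one_lt hp hκ hcκ
  have hκ0 : 0 < κ i := by linarith [hcκ i, F.one_lt]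
  have hw0 := weights_pos hp i
  have hw1 := weights_le_one hp i
  obtain ⟨θ, hθ, hθ1⟩ : ∃ θ : ℝ, MvPolynomial.pderiv 0 (weightPoly 1 i) = MvPolynomial.C θ ∧
      |θ| = 1 := by
    refine Fin.lastCases ⟨-1, ?_, by simp⟩ (fun j => ⟨1, ?_, by simp⟩) i
    · rw [weightPoly, Fin.snoc_last]
      simp
    · rw [Subsingleton.elim j 0, weightPoly, Fin.snoc_castSucc]
      simp
  have key : ∀ k, n ≤ k → (k.descFactorial n : ℝ) ≤ K * |b - a| ^ alphaMinus f p := by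
    intro k hk
    obtain ⟨x, hx⟩ := F.surjective_orbit (ω := fun _ => i) k a
    obtain ⟨y, hy⟩ := F.surjective_orbit (ω := fun _ => i) k b
    have hxI : orbit f (fun _ => i) k x ∈ Set.Icc a b := by
      rw [hx]; exact Set.left_mem_Icc.2 F.lt.le
    have hyI : orbit f (fun _ => i) k y ∈ Set.Icc a b := by
      rw [hy]; exact Set.right_mem_Icc.2 F.lt.le
    have h1 := hK x (F.orbit_mem_of_le k.zero_le hxI) y (F.orbit_mem_of_le k.zero_le hyI)
    have hinc : |takagiFun f p (fun _ => n) y - takagiFun f p (fun _ => n) x| =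
        k.descFactorial n * weights p i ^ (k - n) := by
      rw [F.takagiFun_sub hp _ hx hy, Finset.prod_const, Finset.card_range]
      have : polyMixedPartial (fun _ => n) (weightPoly 1 i ^ k) =
          (MvPolynomial.pderiv 0)^[n] (weightPoly 1 i ^ k) := by
        simp [polyMixedPartial, List.finRange_succ]
      rw [this, iterate_pderiv_pow hθ, map_mul, MvPolynomial.eval_C, map_pow, eval_weightPoly,
        abs_mul, abs_mul, abs_pow, hθ1, one_pow, one_mul, Nat.abs_cast,
        abs_of_pos (pow_pos hw0 _)]
    have hlen : |y - x| = (κ i)⁻¹ ^ k * |b - a| := by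
      have := abs_orbit_sub_of_deriv_eq hf (hκ i) k x y
      rw [hx, hy, abs_of_pos hκ0] at this
      rw [this, ← mul_assoc, ← mul_pow, inv_mul_cancel₀ hκ0.ne', one_pow, one_mul]
    have hpow : |y - x| ^ alphaMinus f p ≤ weights p i ^ k * |b - a| ^ alphaMinus f p := by
      rw [hlen, Real.mul_rpow (by positivity) (abs_nonneg _), ← Real.rpow_natCast,
        ← Real.rpow_mul (inv_pos.2 hκ0).le, mul_comm (k : ℝ), Real.rpow_mul (inv_pos.2 hκ0).le,
        Real.rpow_natCast]
      gcongr
    have h2 : k.descFactorial n * weights p i ^ k ≤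
        K * |b - a| ^ alphaMinus f p * weights p i ^ k := by
      calc k.descFactorial n * weights p i ^ k
          ≤ k.descFactorial n * weights p i ^ (k - n) := by
            gcongr ?_ * ?_
            exact pow_le_pow_of_le_one hw0.le hw1 (Nat.sub_le k n)
        _ ≤ K * |y - x| ^ alphaMinus f p := by rw [← hinc]; exact h1
        _ ≤ K * (weights p i ^ k * |b - a| ^ alphaMinus f p) := by gcongr
        _ = _ := by ring
    exact le_of_mul_le_mul_right h2 (pow_pos hw0 k)
  obtain ⟨m, hm⟩ := exists_nat_gt (K * |b - a| ^ alphaMinus f p)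
  have h3 := key (n + m) (by omega)
  have h4 : m ≤ (n + m).descFactorial n := by
    calc m ≤ n + m + 1 - n := by omega
      _ ≤ (n + m + 1 - n) ^ n := Nat.le_self_pow (by omega) _
      _ ≤ _ := Nat.pow_sub_le_descFactorial _ _
  have h5 : (m : ℝ) ≤ ((n + m).descFactorial n : ℕ) := Nat.cast_le.2 h4
  linarith

end GenTakagi

theorem proposition4p5 {s : ℕ} (hs : 1 ≤ s)
    (d : EReal → EReal → ℝ) (hd : GenTakagi.IsCompactificationMetric d)
    (f : Fin (s + 1) → ℝ → ℝ)
    (hf : GenTakagi.IsC1HolderFamily f)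
    (hexp : GenTakagi.IsExpanding f)
    (hfix : GenTakagi.HasNoCommonFixedPoint f)
    (hinf : GenTakagi.IsContractingNearInfinity d f)
    (hosc : GenTakagi.OpenSetCondition f)
    (p : Fin s → ℝ) (hp : GenTakagi.IsParam p) :
    -- (1)
    (GenTakagi.alphaMinus f p = GenTakagi.alphaPlus f p →
      (GenTakagi.takagiSpace f p : Set (EReal → ℝ)) ∩
          GenTakagi.holderSpace d (GenTakagi.alphaMinus f p) =
        {h | ∃ c : ℝ, h = c • GenTakagi.probInfty f p}) ∧
    -- (2)
    (s = 1 → (∀ i, ∃ c : ℝ, ∀ x, deriv (f i) x = c) → ∀ n : ℕ, 1 ≤ n →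
      GenTakagi.takagiFun f p (fun _ => n) ∉
        GenTakagi.holderSpace d (GenTakagi.alphaMinus f p)) ∧
    -- in both cases the bound `α < α₋` for the Hölder exponents cannot be relaxed to `α ≤ α₋`
    (GenTakagi.alphaMinus f p = GenTakagi.alphaPlus f p ∨
        (s = 1 ∧ ∀ i, ∃ c : ℝ, ∀ x, deriv (f i) x = c) →
      ¬ (GenTakagi.takagiSpace f p : Set (EReal → ℝ)) ⊆
          GenTakagi.holderSpace d (GenTakagi.alphaMinus f p)) := by
  open GenTakagi in
  obtain ⟨c, hc1, hc⟩ := hexp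
  obtain ⟨a, b, F⟩ := exists_isFrame hf hc1 hc hfix hosc
  have h2 : s = 1 → (∀ i, ∃ c : ℝ, ∀ x, deriv (f i) x = c) → ∀ n : ℕ, 1 ≤ n →
      takagiFun f p (fun _ => n) ∉ holderSpace d (alphaMinus f p) := by
    intro h1 hconst n hn
    subst h1
    exact F.takagiFun_notMem_holderSpace hd hf hc hp hconst hn
  refine ⟨fun hα => Set.Subset.antisymm ?_ ?_, h2, ?_⟩
  · rintro h ⟨hT, hH⟩
    obtain ⟨r, rfl⟩ := Finsupp.mem_span_range_iff_exists_finsupp.1 hT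
    refine ⟨r 0, ?_⟩
    rw [Finsupp.sum_eq_single 0 (fun n hn h0 => absurd
      (F.coeff_eq_zero_of_mem_holderSpace hd hf hc hp hα r hH h0) hn) (fun _ => by rw [zero_smul]),
      takagiFun_zero]
  · rintro _ ⟨z, rfl⟩
    constructor
    · exact Submodule.smul_mem _ z (Submodule.subset_span ⟨0, takagiFun_zero f p⟩)
    · obtain ⟨K, hK⟩ := F.probInfty_mem_holderSpace hd hf hc hp hα
      refine ⟨|z| * K, fun x y => ?_⟩
      rw [Pi.smul_apply, Pi.smul_apply, smul_eq_mul, smul_eq_mul, ← mul_sub, abs_mul, mul_assoc]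
      exact mul_le_mul_of_nonneg_left (hK x y) (abs_nonneg z)
  · rintro (hα | ⟨h1, hconst⟩) hsub
    · have hne : (Pi.single ⟨0, hs⟩ 1 : Fin s → ℕ) ≠ 0 := by
        simp
      have hmem := hsub (Submodule.subset_span
        ⟨Pi.single ⟨0, hs⟩ 1, rfl⟩ : takagiFun f p (Pi.single ⟨0, hs⟩ 1) ∈ takagiSpace f p)
      have h0 := F.coeff_eq_zero_of_mem_holderSpace hd hf hc hp hα
        (Finsupp.single (Pi.single ⟨0, hs⟩ 1) 1) (by
          rw [Finsupp.sum_single_index (by rw [zero_smul]), one_smul]; exact hmem) hne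
      simp at h0
    · exact h2 h1 hconst 1 le_rfl (hsub (Submodule.subset_span ⟨fun _ => 1, rfl⟩))
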